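/- Let $1<\alpha<2$, $1<p<\alpha$ and $0<d<1-\frac1\alpha$. Let $\{L_\alpha(t)\}_{t\in\mathbb R}$ be a symmetric $\alpha$-stable motion with Lebesgue control measure on a probability space $(\Omega,\mathcal F,\mathbb P)$, that is, $L_\alpha(0)=0$ a.s., increments over disjoint intervals are independent, and $\mathbb E\,e^{i\theta(L_\alpha(t)-L_\alpha(s))}=e^{-(t-s)|\theta|^\alpha}$ for all $s\le t$ and $\theta\in\mathbb R$. A simple function is a function $\phi=\sum_{i=1}^{n-1}a_i\mathbf 1_{(t_i,t_{i+1}]}$ with $a_i\in\mathbb R$ and $t_1<\dots<t_n$; for a process $X$ put $\int\phi\,dX=\sum_{i=1}^{n-1}a_i\,(X(t_{i+1})-X(t_i))$. For $f\in L^\alpha(\mathbb R)$, $\int_{\mathbb R} f\,dL_\alpha$ denotes the common limit in probability of $\int\phi_n\,dL_\alpha$ over all sequences of simple functions $\phi_n\to f$ in $L^\alpha(\mathbb R)$. Let $$M_d(t)=\frac1{\Gamma(d+1)}\int_{\mathbb R}\big[(t-x)_+^d-(-x)_+^d\big]\,dL_\alpha(x),\quad t\in\mathbb R,\qquad (I_-^dg)(x)=\frac1{\Gamma(d)}\int_x^\infty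 g(t)(t-x)^{d-1}\,dt,$$ where $M_d$ is the linear fractional stable motion and $I_-^d$ the right-sided Riemann–Liouville fractional integral. Put $\|g\|_{\alpha,p}=\big(\mathbb E|L_\alpha(1)|^p\big)^{1/p}\,\|I_-^dg\|_{L^\alpha(\mathbb R)}$ for $g\in L^1(\mathbb R)\cap L^\alpha(\mathbb R)$, and let $B_{\alpha,p}$ be the space $L^1(\mathbb R)\cap L^\alpha(\mathbb R)$ with $g$ and $h$ identified when $\|g-h\|_{\alpha,p}=0$. For $g\in B_{\alpha,p}$, $\int_{\mathbb R} g\,dM_d$ denotes the common limit in $L^p(\Omega,\mathbb P)$ of $\int\phi_n\,dM_d$ over all sequences of simple functions with $\|\phi_n-g\|_{\alpha,p}\to0$. Theorem (integration by parts). For every $g\in B_{\alpha,p}$ the integrals above, those defining $M_d(t)$, $t\in\mathbb R$, included, exist (approximating sequences exist and the limits do not depend on their choice), $\int_{\mathbb R} g\,dM_d$ depends only on the class of $g$ in $B_{\alpha,p}$, and $$\int_{\mathbb R} g(x)\,dM_d(x)=\int_{\mathbb R}(I_-^dg)(x)\,dL_\alpha(x)\qquad\text{almost surely.}$$ -/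

import Mathlib

open MeasureTheory ProbabilityTheory Filter Topology
open scoped ENNReal

namespace StableIBP

noncomputable section

/-- `X` has the symmetric `α`-stable law `S_α(σ, 0, 0)` under `P`, i.e. its characteristic
function is `θ ↦ exp (-σ ^ α |θ| ^ α)`. -/
def HasSymmetricStableLaw {Ω : Type*} [MeasurableSpace Ω] (P : Measure Ω) (α σ : ℝ)
    (X : Ω → ℝ) : Prop :=
  AEMeasurable X P ∧
    ∀ θ : ℝ, charFun (P.map X) θ = Complex.exp (-((σ ^ α * |θ| ^ α : ℝ) : ℂ))

/-- `L = (L t)_{t ∈ ℝ}` is a two-sided symmetric `α`-stable motion whose control measure is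
Lebesgue measure: `L 0 = 0` almost surely, the increments over disjoint intervals are independent,
and `L t - L s ∼ S_α((t - s)^{1/α}, 0, 0)` for `s ≤ t`. -/
structure IsStableMotion {Ω : Type*} [MeasurableSpace Ω] (P : Measure Ω) (α : ℝ)
    (L : ℝ → Ω → ℝ) : Prop where
  aemeasurable : ∀ t, AEMeasurable (L t) P
  zero : L 0 =ᵐ[P] 0
  indep : HasIndepIncrements L P
  law : ∀ s t, s ≤ t → HasSymmetricStableLaw P α ((t - s) ^ (1 / α)) (L t - L s)

/-- The data of a simple (step) function `∑ a_i 1_{(t_i, t_{i+1}]}` on the real line, with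
`t_0 < t_1 < ⋯ < t_n`. -/
structure SimpleFn where
  /-- the number of intervals -/
  n : ℕ
  /-- the coefficients -/
  a : Fin n → ℝ
  /-- the nodes -/
  t : Fin (n + 1) → ℝ
  strictMono : StrictMono t

/-- The function `x ↦ ∑ a_i 1_{(t_i, t_{i+1}]}(x)`. -/
def SimpleFn.toFun (φ : SimpleFn) (x : ℝ) : ℝ :=
  ∑ i : Fin φ.n, (Set.Ioc (φ.t i.castSucc) (φ.t i.succ)).indicator (fun _ => φ.a i) x

/-- The integral `∑ a_i (X (t_{i+1}) - X (t_i))` of a simple function with respect to a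
process `X`. -/
def SimpleFn.integral {Ω : Type*} (φ : SimpleFn) (X : ℝ → Ω → ℝ) (ω : Ω) : ℝ :=
  ∑ i : Fin φ.n, φ.a i * (X (φ.t i.succ) ω - X (φ.t i.castSucc) ω)

/-- `Y` is (a version of) the stable stochastic integral `∫ f dL` of `f ∈ L^α(ℝ)`: there are
simple functions converging to `f` in `L^α(ℝ)`, and for every such sequence the integrals of the
simple functions with respect to `L` converge to `Y` in probability. -/
def IsStableIntegral {Ω : Type*} [MeasurableSpace Ω] (P : Measure Ω) (α : ℝ) (L : ℝ → Ω → ℝ)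
    (f : ℝ → ℝ) (Y : Ω → ℝ) : Prop :=
  MemLp f (ENNReal.ofReal α) volume ∧ AEMeasurable Y P ∧
  (∃ φ : ℕ → SimpleFn,
    Tendsto (fun n => eLpNorm ((φ n).toFun - f) (ENNReal.ofReal α) volume) atTop (𝓝 0)) ∧
  ∀ φ : ℕ → SimpleFn,
    Tendsto (fun n => eLpNorm ((φ n).toFun - f) (ENNReal.ofReal α) volume) atTop (𝓝 0) →
    TendstoInMeasure P (fun n => (φ n).integral L) atTop Y

open Classical in
/-- The stable stochastic integral `∫ f dL` (the zero variable if it does not exist). -/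
def stableIntegral {Ω : Type*} [MeasurableSpace Ω] (P : Measure Ω) (α : ℝ) (L : ℝ → Ω → ℝ)
    (f : ℝ → ℝ) : Ω → ℝ :=
  if h : ∃ Y, IsStableIntegral P α L f Y then h.choose else 0

/-- The right-sided Riemann–Liouville fractional integral
`(I_-^d f)(x) = Γ(d)⁻¹ ∫_x^∞ f(t) (t - x)^{d-1} dt`. -/
def fracIntegral (d : ℝ) (f : ℝ → ℝ) (x : ℝ) : ℝ :=
  1 / Real.Gamma d * ∫ t in Set.Ioi x, f t * (t - x) ^ (d - 1)

/-- The kernel `x ↦ (t - x)_+^d - (-x)_+^d`. -/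
def lfsmKernel (d t x : ℝ) : ℝ :=
  (max (t - x) 0) ^ d - (max (-x) 0) ^ d

/-- The linear fractional stable motion
`M_d(t) = Γ(d+1)⁻¹ ∫ ((t - x)_+^d - (-x)_+^d) dL(x)`. -/
def lfsm {Ω : Type*} [MeasurableSpace Ω] (P : Measure Ω) (α d : ℝ) (L : ℝ → Ω → ℝ)
    (t : ℝ) (ω : Ω) : ℝ :=
  1 / Real.Gamma (d + 1) * stableIntegral P α L (lfsmKernel d t) ω

/-- The norm `‖g‖_{α,p} = (E |L(1)|^p)^{1/p} ‖I_-^d g‖_{L^α(ℝ)}`, as an extended number. -/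
def normB {Ω : Type*} [MeasurableSpace Ω] (P : Measure Ω) (α p d : ℝ) (L : ℝ → Ω → ℝ)
    (g : ℝ → ℝ) : ℝ≥0∞ :=
  eLpNorm (L 1) (ENNReal.ofReal p) P * eLpNorm (fracIntegral d g) (ENNReal.ofReal α) volume

/-- `g` represents an element of `B_{α,p}`, i.e. `g ∈ L^1(ℝ) ∩ L^α(ℝ)`. Two representatives
`g, h` are identified when `EquivB P α p d L g h`. -/
def MemB (α : ℝ) (g : ℝ → ℝ) : Prop :=
  MemLp g 1 volume ∧ MemLp g (ENNReal.ofReal α) volume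

/-- The relation `g ∼_{α,p} h ↔ ‖g - h‖_{α,p} = 0` by which `L^1(ℝ) ∩ L^α(ℝ)` is divided to
obtain `B_{α,p}`. -/
def EquivB {Ω : Type*} [MeasurableSpace Ω] (P : Measure Ω) (α p d : ℝ) (L : ℝ → Ω → ℝ)
    (g h : ℝ → ℝ) : Prop :=
  normB P α p d L (g - h) = 0

/-- `Y ∈ L^p(Ω, P)` is (a version of) the stochastic integral `∫ g dM_d`: there are simple
functions `φ_n` with `‖φ_n - g‖_{α,p} → 0`, and for every such sequence the integrals of `φ_n` with
respect to `M_d` converge to `Y` in `L^p(Ω, P)`. -/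
def IsLfsmIntegral {Ω : Type*} [MeasurableSpace Ω] (P : Measure Ω) (α p d : ℝ)
    (L : ℝ → Ω → ℝ) (g : ℝ → ℝ) (Y : Ω → ℝ) : Prop :=
  MemB α g ∧ MemLp Y (ENNReal.ofReal p) P ∧
  (∃ φ : ℕ → SimpleFn,
    Tendsto (fun n => normB P α p d L ((φ n).toFun - g)) atTop (𝓝 0)) ∧
  ∀ φ : ℕ → SimpleFn,
    Tendsto (fun n => normB P α p d L ((φ n).toFun - g)) atTop (𝓝 0) →
    Tendsto (fun n => eLpNorm ((φ n).integral (lfsm P α d L) - Y) (ENNReal.ofReal p) P)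
      atTop (𝓝 0)

open Classical in
/-- The stochastic integral `∫ g dM_d` (the zero variable if it does not exist). -/
def lfsmIntegral {Ω : Type*} [MeasurableSpace Ω] (P : Measure Ω) (α p d : ℝ)
    (L : ℝ → Ω → ℝ) (g : ℝ → ℝ) : Ω → ℝ :=
  if h : ∃ Y, IsLfsmIntegral P α p d L g Y then h.choose else 0

end

end StableIBP

namespace StableIBP

/-! By independence and stability, the integral of a simple function `φ` against `L` has the law of
`‖φ‖_α · L 1`. Since `L 1` has finite `p`-th moment for `p < α`, the integral is, up to the constant
`‖L 1‖_p`, an isometry from step functions in `L^α(ℝ)` to `L^p(Ω)`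
(`IsStableMotion.eLpNorm_integral`). It therefore extends to all of `L^α(ℝ)` by completeness, with a
limit independent of the approximating sequence.

The fractional integral sends the indicator of `(s, t]` to `Γ(d+1)⁻¹` times the difference of the
kernels of `M_d(t)` and `M_d(s)`. Linearity thus gives integration by parts for step functions
(`IsStableMotion.hasStableIntegral_fracIntegral_toFun`). Combined with the isometry, this makes the
`L^p` distance between `∫ φ dM_d` and `∫ I_-^d g dL` exactly `‖φ - g‖_{α,p}`, so convergence in this
norm is the same as convergence of the integrals to `∫ I_-^d g dL`.

Two analytic facts provide approximating sequences. `I_-^d` is bounded from `L^1 ∩ L^α` to `L^α`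
(`exists_eLpNorm_fracIntegral_le`): its kernel is integrable near `0` because `d > 0`, and lies in
`L^α` near infinity because `(d - 1) α < -1`. Step functions approximate in `L^1` and `L^α`
simultaneously (`SimpleFn.exists_seq_tendsto`). -/

/-! ### Linear combinations of simple functions -/

/-- The sum `∑ a_i • (G (t_{i+1}) - G (t_i))` attached to a simple function and a path `G`. -/
def SimpleFn.sum {M : Type*} [AddCommGroup M] [Module ℝ M] (φ : SimpleFn) (G : ℝ → M) : M :=
  ∑ i : Fin φ.n, φ.a i • (G (φ.t i.succ) - G (φ.t i.castSucc))

/-- Telescoping; it expresses an increment over a coarse partition through the increments of a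
refinement. -/
lemma sub_mem_span_increments {M : Type*} [AddCommGroup M] [Module ℝ M] {n : ℕ}
    (H : Fin (n + 1) → M) (i j : Fin (n + 1)) :
    H i - H j ∈ Submodule.span ℝ (Set.range fun k : Fin n => H k.succ - H k.castSucc) := by
  have h0 : ∀ i : Fin (n + 1), H i - H 0 ∈
      Submodule.span ℝ (Set.range fun k : Fin n => H k.succ - H k.castSucc) := by
    intro i
    induction i using Fin.induction with
    | zero => simp
    | succ k ih =>
      have h := Submodule.add_mem _ (Submodule.subset_span (s := Set.range
        fun k : Fin n => H k.succ - H k.castSucc) (Set.mem_range_self k)) ih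
      simpa using h
  simpa using Submodule.sub_mem _ (h0 i) (h0 j)

/-- The union of the two node sets is a common refinement. The path takes values in an arbitrary
module so that several paths can be handled at once by passing to a product. -/
lemma SimpleFn.exists_sum_add_smul {M : Type*} [AddCommGroup M] [Module ℝ M] (G : ℝ → M)
    (φ ψ : SimpleFn) (c : ℝ) : ∃ χ : SimpleFn, χ.sum G = φ.sum G + c • ψ.sum G := by
  classical
  let T : Finset ℝ := Finset.univ.image φ.t ∪ Finset.univ.image ψ.t
  have hT : T.card = (T.card - 1) + 1 :=
    (Nat.sub_add_cancel (Finset.card_pos.2 ⟨φ.t 0, by simp [T]⟩)).symm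
  let e := T.orderEmbOfFin hT
  have hrange : ∀ x ∈ T, ∃ k, e k = x := fun x hx => by
    have : x ∈ Set.range e := by rw [Finset.range_orderEmbOfFin]; exact hx
    exact this
  have hmem : ∀ θ : SimpleFn, (∀ i, θ.t i ∈ T) → θ.sum G ∈ Submodule.span ℝ
      (Set.range fun k : Fin (T.card - 1) => G (e k.succ) - G (e k.castSucc)) := by
    intro θ hθ
    refine Submodule.sum_mem _ fun i _ => Submodule.smul_mem _ _ ?_
    obtain ⟨j, hj⟩ := hrange _ (hθ i.succ)
    obtain ⟨k, hk⟩ := hrange _ (hθ i.castSucc)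
    rw [← hj, ← hk]
    exact sub_mem_span_increments (fun k => G (e k)) j k
  have h := Submodule.add_mem _ (hmem φ fun i => by simp [T])
    (Submodule.smul_mem _ c (hmem ψ fun i => by simp [T]))
  obtain ⟨a, ha⟩ := (Submodule.mem_span_range_iff_exists_fun ℝ).1 h
  exact ⟨⟨_, a, e, e.strictMono⟩, ha⟩

lemma SimpleFn.integral_eq_sum {Ω : Type*} (φ : SimpleFn) (X : ℝ → Ω → ℝ) :
    φ.integral X = φ.sum X := by
  ext ω
  simp [SimpleFn.integral, SimpleFn.sum]

/-- The indicator of `(s, t]` is the increment of the path `t ↦ 1_{(-∞, t]}`, so step functions are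
themselves sums against a path. -/
lemma SimpleFn.toFun_eq_sum (φ : SimpleFn) :
    φ.toFun = φ.sum fun t => (Set.Iic t).indicator fun _ => (1 : ℝ) := by
  ext x
  simp only [SimpleFn.toFun, SimpleFn.sum, Finset.sum_apply, Pi.smul_apply, Pi.sub_apply,
    smul_eq_mul]
  refine Finset.sum_congr rfl fun i _ => ?_
  have := φ.strictMono i.castSucc_lt_succ
  by_cases h1 : x ≤ φ.t i.castSucc
  · simp [h1, h1.trans this.le]
  · by_cases h2 : x ≤ φ.t i.succ <;> simp [h1, h2, not_le.1 h1]

lemma SimpleFn.sum_prod {M N : Type*} [AddCommGroup M] [Module ℝ M] [AddCommGroup N] [Module ℝ N]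
    (φ : SimpleFn) (G : ℝ → M) (H : ℝ → N) :
    φ.sum (fun t => (G t, H t)) = (φ.sum G, φ.sum H) := by
  ext <;> simp [SimpleFn.sum, Prod.fst_sum, Prod.snd_sum]

lemma SimpleFn.exists_add_smul {Ω : Type*} (X : ℝ → Ω → ℝ) (φ ψ : SimpleFn) (c : ℝ) :
    ∃ χ : SimpleFn, χ.toFun = φ.toFun + c • ψ.toFun ∧
      χ.integral X = φ.integral X + c • ψ.integral X := by
  -- Pairing the indicator path with `X` makes one and the same `χ` serve both identities.
  obtain ⟨χ, hχ⟩ := SimpleFn.exists_sum_add_smul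
    (fun t => ((Set.Iic t).indicator (fun _ => (1 : ℝ)), X t)) φ ψ c
  rw [SimpleFn.sum_prod, SimpleFn.sum_prod, SimpleFn.sum_prod, ← SimpleFn.toFun_eq_sum,
    ← SimpleFn.toFun_eq_sum, ← SimpleFn.toFun_eq_sum] at hχ
  simp only [← SimpleFn.integral_eq_sum] at hχ
  exact ⟨χ, congrArg Prod.fst hχ, congrArg Prod.snd hχ⟩

/-! ### Norms of step functions -/

lemma SimpleFn.measurable_toFun (φ : SimpleFn) : Measurable φ.toFun := by
  unfold SimpleFn.toFun
  exact Finset.measurable_sum _ fun i _ => measurable_const.indicator measurableSet_Ioc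

/-- A function of a step function vanishing at zero is again a step function. -/
lemma SimpleFn.comp_toFun (φ : SimpleFn) (F : ℝ → ℝ≥0∞) (hF : F 0 = 0) (x : ℝ) :
    F (φ.toFun x) = ∑ i : Fin φ.n,
      (Set.Ioc (φ.t i.castSucc) (φ.t i.succ)).indicator (fun _ => F (φ.a i)) x := by
  by_cases h : ∃ i : Fin φ.n, x ∈ Set.Ioc (φ.t i.castSucc) (φ.t i.succ)
  · obtain ⟨i, hi⟩ := h
    -- The intervals are pairwise disjoint, so at most one term of either sum survives.
    have hne : ∀ j, j ≠ i → x ∉ Set.Ioc (φ.t j.castSucc) (φ.t j.succ) := by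
      intro j hj hx
      rcases lt_or_gt_of_ne hj with h | h
      · exact absurd (hx.2.trans (φ.strictMono.monotone (Fin.succ_le_castSucc_iff.2 h)))
          (not_le.2 hi.1)
      · exact absurd (hi.2.trans (φ.strictMono.monotone (Fin.succ_le_castSucc_iff.2 h)))
          (not_le.2 hx.1)
    rw [SimpleFn.toFun, Finset.sum_eq_single i, Finset.sum_eq_single i]
    · simp [Set.indicator_of_mem hi]
    · intro j _ hj; exact Set.indicator_of_notMem (hne j hj) _
    · simp
    · intro j _ hj; exact Set.indicator_of_notMem (hne j hj) _
    · simp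
  · push Not at h
    rw [SimpleFn.toFun, Finset.sum_eq_zero, Finset.sum_eq_zero, hF]
    · intro j _; exact Set.indicator_of_notMem (h j) _
    · intro j _; exact Set.indicator_of_notMem (h j) _

/-- The sum `∑ (t_{i+1} - t_i) |a_i|^α`, i.e. `∫ |φ|^α`. -/
noncomputable def SimpleFn.powerSum (φ : SimpleFn) (α : ℝ) : ℝ :=
  ∑ i : Fin φ.n, (φ.t i.succ - φ.t i.castSucc) * |φ.a i| ^ α

lemma SimpleFn.powerSum_nonneg (φ : SimpleFn) (α : ℝ) : 0 ≤ φ.powerSum α :=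
  Finset.sum_nonneg fun i _ => mul_nonneg
    (sub_nonneg.2 (φ.strictMono i.castSucc_lt_succ).le) (by positivity)

lemma SimpleFn.eLpNorm_toFun (φ : SimpleFn) {α : ℝ} (hα : 0 < α) :
    eLpNorm φ.toFun (ENNReal.ofReal α) volume = ENNReal.ofReal (φ.powerSum α ^ (1 / α)) := by
  rw [eLpNorm_eq_lintegral_rpow_enorm_toReal (by simpa using hα) ENNReal.ofReal_ne_top,
    ENNReal.toReal_ofReal hα.le, ← ENNReal.ofReal_rpow_of_nonneg (φ.powerSum_nonneg α)
      (by positivity)]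
  congr 1
  simp_rw [φ.comp_toFun (fun y => ‖y‖ₑ ^ α) (by simp [hα])]
  rw [lintegral_finsetSum _ fun i _ => measurable_const.indicator measurableSet_Ioc,
    SimpleFn.powerSum, ENNReal.ofReal_sum_of_nonneg fun i _ => mul_nonneg
    (sub_nonneg.2 (φ.strictMono i.castSucc_lt_succ).le) (by positivity)]
  refine Finset.sum_congr rfl fun i _ => ?_
  rw [lintegral_indicator_const measurableSet_Ioc, Real.volume_Ioc, mul_comm,
    ENNReal.ofReal_mul (sub_nonneg.2 (φ.strictMono i.castSucc_lt_succ).le),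
    ← ENNReal.ofReal_rpow_of_nonneg (abs_nonneg _) hα.le, Real.enorm_eq_ofReal_abs]

lemma SimpleFn.memLp_toFun (φ : SimpleFn) {α : ℝ} (hα : 0 < α) :
    MemLp φ.toFun (ENNReal.ofReal α) volume :=
  ⟨φ.measurable_toFun.aestronglyMeasurable, by
    rw [φ.eLpNorm_toFun hα]; exact ENNReal.ofReal_lt_top⟩

/-! ### Moments of stable laws and the isometry on simple functions -/

/-- Absolute moments of order `p < α` of a standard symmetric `α`-stable law are finite. -/
lemma memLp_id_of_charFun_eq (μ : Measure ℝ) [IsProbabilityMeasure μ] {α p : ℝ} (hα : 0 < α)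
    (hp : 0 < p) (hpα : p < α)
    (h : ∀ θ : ℝ, charFun μ θ = Complex.exp (-((|θ| ^ α : ℝ) : ℂ))) :
    MemLp id (ENNReal.ofReal p) μ := by
  -- The tail beyond `r` is controlled by the mean of `1 - charFun` over `|t| ≤ 2/r`, and `1 - exp
  -- (-u) ≤ u` turns this into a bound of order `r ^ (-α)`.
  have hbound : ∀ r : ℝ, 0 < r → μ.real {x | r < |x|} ≤ 2 * 2 ^ α * r ^ (-α) := by
    intro r hr
    have h1 := measureReal_abs_gt_le_integral_charFun (μ := μ) hr
    have h2 : ‖∫ t in (-2 * r⁻¹)..(2 * r⁻¹), 1 - charFun μ t‖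
        ≤ (2 * r⁻¹) ^ α * |2 * r⁻¹ - -2 * r⁻¹| := by
      refine intervalIntegral.norm_integral_le_of_norm_le_const fun t ht => ?_
      have hr' : 0 < r⁻¹ := inv_pos.2 hr
      rw [Set.uIoc_of_le (by linarith)] at ht
      have ht' : |t| ≤ 2 * r⁻¹ := abs_le.2 ⟨by linarith [ht.1], ht.2⟩
      rw [h, ← Complex.ofReal_neg, ← Complex.ofReal_exp, ← Complex.ofReal_one,
        ← Complex.ofReal_sub, Complex.norm_real, Real.norm_eq_abs, abs_of_nonneg]
      · have := Real.add_one_le_exp (-|t| ^ α)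
        have h3 : |t| ^ α ≤ (2 * r⁻¹) ^ α := by gcongr
        linarith
      · have : Real.exp (-|t| ^ α) ≤ 1 := Real.exp_le_one_iff.2 (by simp; positivity)
        linarith
    calc μ.real {x | r < |x|} ≤ 2⁻¹ * r * ((2 * r⁻¹) ^ α * |2 * r⁻¹ - -2 * r⁻¹|) :=
          h1.trans (by gcongr)
      _ = 2 * 2 ^ α * r ^ (-α) := by
          rw [abs_of_nonneg (by ring_nf; positivity), Real.mul_rpow (by positivity)
            (by positivity), Real.inv_rpow hr.le, Real.rpow_neg hr.le]
          field_simp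
          ring
  have hpos : ∀ᵐ x ∂μ, (0 : ℝ) ≤ |x| := ae_of_all _ fun _ => abs_nonneg _
  refine ⟨aestronglyMeasurable_id, ?_⟩
  rw [eLpNorm_lt_top_iff_lintegral_rpow_enorm_lt_top (by simpa using hp) ENNReal.ofReal_ne_top,
    ENNReal.toReal_ofReal hp.le]
  have hint : ∫⁻ x, ‖id x‖ₑ ^ p ∂μ = ∫⁻ x, ENNReal.ofReal (|x| ^ p) ∂μ := by
    simp_rw [id, Real.enorm_eq_ofReal_abs, ENNReal.ofReal_rpow_of_nonneg (abs_nonneg _) hp.le]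
  rw [hint, lintegral_rpow_eq_lintegral_meas_lt_mul μ hpos (by fun_prop) hp]
  refine ENNReal.mul_lt_top ENNReal.ofReal_lt_top ?_
  -- In the layer-cake integral, probabilities are at most `1` on `(0, 1]`, where `p - 1 > -1`
  -- suffices; beyond `1` the tail bound leaves `t ^ (p - 1 - α)`, integrable because `p < α`.
  rw [← Set.Ioc_union_Ioi_eq_Ioi (zero_le_one (α := ℝ))]
  refine (lintegral_union_le _ _ _).trans_lt (ENNReal.add_lt_top.2 ⟨?_, ?_⟩)
  · have hi : IntegrableOn (fun t : ℝ => t ^ (p - 1)) (Set.Ioc 0 1) :=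
      (intervalIntegrable_iff_integrableOn_Ioc_of_le zero_le_one).1
        (intervalIntegral.intervalIntegrable_rpow' (by linarith))
    refine lt_of_le_of_lt (setLIntegral_mono' measurableSet_Ioc fun t _ => ?_)
      hi.lintegral_lt_top
    exact (mul_le_mul_left prob_le_one _).trans (one_mul _).le
  · have hi : IntegrableOn (fun t : ℝ => 2 * 2 ^ α * t ^ (p - 1 - α)) (Set.Ioi 1) :=
      (integrableOn_Ioi_rpow_of_lt (by linarith) zero_lt_one).const_mul _
    refine lt_of_le_of_lt (setLIntegral_mono' measurableSet_Ioi fun t ht => ?_)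
      hi.lintegral_lt_top
    have ht0 : 0 < t := zero_lt_one.trans ht
    have := hbound t ht0
    rw [← ofReal_measureReal, ← ENNReal.ofReal_mul measureReal_nonneg]
    refine ENNReal.ofReal_le_ofReal ?_
    calc _ ≤ 2 * 2 ^ α * t ^ (-α) * t ^ (p - 1) := by gcongr
      _ = _ := by rw [mul_assoc, ← Real.rpow_add ht0]; ring_nf

section

variable {Ω : Type*} [MeasurableSpace Ω] {P : Measure Ω} {α p : ℝ} {L : ℝ → Ω → ℝ}

lemma SimpleFn.aemeasurable_integral {X : ℝ → Ω → ℝ} (hX : ∀ t, AEMeasurable (X t) P)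
    (φ : SimpleFn) : AEMeasurable (φ.integral X) P := by
  unfold SimpleFn.integral
  exact Finset.aemeasurable_fun_sum _ fun i _ => ((hX _).sub (hX _)).const_mul _

lemma IsStableMotion.charFun_increment (hL : IsStableMotion P α L) (hα : 0 < α) {s t : ℝ}
    (hst : s ≤ t) (θ : ℝ) : charFun (P.map (L t - L s)) θ =
      Complex.exp (-(((t - s) * |θ| ^ α : ℝ) : ℂ)) := by
  rw [(hL.law s t hst).2, ← Real.rpow_mul (sub_nonneg.2 hst), one_div_mul_cancel hα.ne',
    Real.rpow_one]

lemma IsStableMotion.charFun_one (hL : IsStableMotion P α L) (hα : 0 < α) (θ : ℝ) :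
    charFun (P.map (L 1)) θ = Complex.exp (-((|θ| ^ α : ℝ) : ℂ)) := by
  have h : L 1 - L 0 =ᵐ[P] L 1 := by
    filter_upwards [hL.zero] with ω hω
    simp [hω]
  rw [← Measure.map_congr h, hL.charFun_increment hα zero_le_one]
  simp

variable [IsProbabilityMeasure P]

lemma IsStableMotion.memLp_one (hL : IsStableMotion P α L) (hp : 0 < p) (hpα : p < α) :
    MemLp (L 1) (ENNReal.ofReal p) P := by
  have := Measure.isProbabilityMeasure_map (μ := P) (hL.aemeasurable 1)
  have h := memLp_id_of_charFun_eq (P.map (L 1)) (hp.trans hpα) hp hpα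
    (hL.charFun_one (hp.trans hpα))
  exact (memLp_map_measure_iff aestronglyMeasurable_id (hL.aemeasurable 1)).1 h

/-- If `L 1` vanished almost surely, its characteristic function at `1` would be `1` instead of `exp
(-1)`. This lets the constant be cancelled from `‖g - h‖_{α,p} = 0`. -/
lemma IsStableMotion.eLpNorm_one_ne_zero (hL : IsStableMotion P α L) (hα : 0 < α) (hp : 0 < p) :
    eLpNorm (L 1) (ENNReal.ofReal p) P ≠ 0 := by
  intro h
  rw [eLpNorm_eq_zero_iff (hL.aemeasurable 1).aestronglyMeasurable (by simpa using hp)] at h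
  have h1 := hL.charFun_one hα 1
  rw [Measure.map_congr h] at h1
  have h2 : charFun (P.map (0 : Ω → ℝ)) 1 = 1 := by
    have : P.map (0 : Ω → ℝ) = Measure.dirac 0 := by
      have := Measure.map_const P (0 : ℝ)
      rwa [measure_univ, one_smul] at this
    rw [this, charFun_dirac]
    simp
  rw [h2] at h1
  simp only [abs_one, Real.one_rpow, Complex.ofReal_one] at h1
  have h3 : (Real.exp (-1) : ℂ) = ((1 : ℝ) : ℂ) := by
    simpa using h1.symm
  have h4 := Complex.ofReal_injective h3
  simp at h4

/-- The integral of a simple function has the law of a multiple of `L 1`. -/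
lemma IsStableMotion.map_integral (hL : IsStableMotion P α L) (hα : 0 < α) (φ : SimpleFn) :
    P.map (φ.integral L) = P.map ((φ.powerSum α ^ (1 / α)) • L 1) := by
  have h1 := Measure.isProbabilityMeasure_map (μ := P) (φ.aemeasurable_integral hL.aemeasurable)
  have h2 := Measure.isProbabilityMeasure_map (μ := P)
    ((hL.aemeasurable 1).const_smul (φ.powerSum α ^ (1 / α)))
  refine Measure.ext_of_charFun (funext fun θ => ?_)
  have hind : iIndepFun (fun (i : Fin φ.n) ω =>
      φ.a i * (L (φ.t i.succ) ω - L (φ.t i.castSucc) ω)) P :=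
    (hL.indep _ φ.t φ.strictMono.monotone).comp (fun i x => φ.a i * x)
      fun i => measurable_const_mul _
  have e1 : charFun (P.map (φ.integral L)) θ =
      ∏ i : Fin φ.n, Complex.exp (-(((φ.t i.succ - φ.t i.castSucc) *
        |φ.a i * θ| ^ α : ℝ) : ℂ)) := by
    have : charFun (P.map (φ.integral L)) = _ := hind.charFun_map_fun_sum_eq_prod
      fun i => ((hL.aemeasurable _).sub (hL.aemeasurable _)).const_mul _
    rw [this, Finset.prod_apply]
    refine Finset.prod_congr rfl fun i _ => ?_
    refine (charFun_map_mul_comp ((hL.aemeasurable _).sub (hL.aemeasurable _)) _ _).trans ?_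
    exact hL.charFun_increment hα (φ.strictMono i.castSucc_lt_succ).le _
  have e2 := charFun_map_smul_comp (hL.aemeasurable 1) (φ.powerSum α ^ (1 / α)) θ
  rw [e1]
  refine Eq.trans ?_ e2.symm
  rw [hL.charFun_one hα, ← Complex.exp_sum, Finset.sum_neg_distrib, ← Complex.ofReal_sum,
    smul_eq_mul, abs_mul, Real.mul_rpow (abs_nonneg _) (abs_nonneg _), abs_of_nonneg
      (Real.rpow_nonneg (φ.powerSum_nonneg α) _), ← Real.rpow_mul (φ.powerSum_nonneg α),
    one_div_mul_cancel hα.ne', Real.rpow_one, SimpleFn.powerSum, Finset.sum_mul]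
  congr 3
  refine Finset.sum_congr rfl fun i _ => ?_
  rw [abs_mul, Real.mul_rpow (abs_nonneg _) (abs_nonneg _), mul_assoc]

/-- The `L^p` norm depends only on the law, which is that of `‖φ‖_α · L 1`. -/
lemma IsStableMotion.eLpNorm_integral (hL : IsStableMotion P α L) (hα : 0 < α)
    (φ : SimpleFn) : eLpNorm (φ.integral L) (ENNReal.ofReal p) P =
      eLpNorm (L 1) (ENNReal.ofReal p) P * eLpNorm φ.toFun (ENNReal.ofReal α) volume := by
  have hm := φ.aemeasurable_integral hL.aemeasurable
  have h := eLpNorm_map_measure (μ := P) (p := ENNReal.ofReal p)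
    (g := id) (f := φ.integral L) aestronglyMeasurable_id hm
  have h' := eLpNorm_map_measure (μ := P) (p := ENNReal.ofReal p) (g := id)
    (f := (φ.powerSum α ^ (1 / α)) • L 1) aestronglyMeasurable_id
    ((hL.aemeasurable 1).const_smul _)
  rw [Function.id_comp] at h h'
  rw [← h, hL.map_integral hα, h', eLpNorm_const_smul, φ.eLpNorm_toFun hα, mul_comm,
    Real.enorm_eq_ofReal (Real.rpow_nonneg (φ.powerSum_nonneg α) _)]

lemma IsStableMotion.memLp_integral (hL : IsStableMotion P α L) (hp : 0 < p) (hpα : p < α)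
    (φ : SimpleFn) : MemLp (φ.integral L) (ENNReal.ofReal p) P :=
  ⟨(φ.aemeasurable_integral hL.aemeasurable).aestronglyMeasurable, by
    rw [hL.eLpNorm_integral (hp.trans hpα)]
    exact ENNReal.mul_lt_top (hL.memLp_one hp hpα).2 (φ.memLp_toFun (hp.trans hpα)).2⟩

end

/-! ### Density of step functions -/

/-- A continuous function is uniformly approximated on `(-N, N]` by a step function supported
there. -/
lemma SimpleFn.exists_approx_continuous {h : ℝ → ℝ} (hh : Continuous h) {N : ℝ} (hN : 0 < N)
    {δ : ℝ} (hδ : 0 < δ) : ∃ φ : SimpleFn, (∀ x ∉ Set.Ioc (-N) N, φ.toFun x = 0) ∧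
      ∀ x ∈ Set.Ioc (-N) N, |φ.toFun x - h x| ≤ δ := by
  have huc : UniformContinuousOn h (Set.Icc (-N) N) :=
    isCompact_Icc.uniformContinuousOn_of_continuous hh.continuousOn
  obtain ⟨η, hη, hη'⟩ := Metric.uniformContinuousOn_iff.1 huc δ hδ
  obtain ⟨m, hm⟩ := exists_nat_gt (2 * N / η)
  have hm0 : (0 : ℝ) < m := lt_of_le_of_lt (by positivity) hm
  have hstep : 2 * N / m < η := by rw [div_lt_iff₀ hm0]; rwa [div_lt_iff₀' hη] at hm
  let t : ℕ → ℝ := fun i => -N + 2 * N / m * i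
  have ht : StrictMono t := fun i j hij => by
    have : (i : ℝ) < j := by exact_mod_cast hij
    have h2 : 0 < 2 * N / m := by positivity
    simp only [t]
    gcongr
  have ht0 : t 0 = -N := by simp [t]
  have htm : t m = N := by simp only [t]; field_simp; ring
  -- On an equidistant grid of mesh below `η`, the step function takes the value of `h` at each
  -- right endpoint.
  let φ : SimpleFn := ⟨m, fun i => h (t (i + 1)), fun i => t i, fun i j hij => ht hij⟩
  have hφ : φ.toFun = fun x => ∑ i ∈ Finset.range m,
      (Set.Ioc (t i) (t (i + 1))).indicator (fun _ => h (t (i + 1))) x := by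
    ext x
    rw [Finset.sum_range]
    rfl
  have hmem : ∀ i < m, t i ∈ Set.Icc (-N) N ∧ t (i + 1) ∈ Set.Icc (-N) N := fun i hi => by
    rw [← ht0, ← htm]
    exact ⟨⟨ht.monotone (Nat.zero_le _), ht.monotone hi.le⟩,
      ⟨ht.monotone (Nat.zero_le _), ht.monotone hi⟩⟩
  refine ⟨φ, fun x hx => ?_, fun x hx => ?_⟩
  · rw [hφ]
    refine Finset.sum_eq_zero fun i hi => Set.indicator_of_notMem (fun hx' => hx ?_) _
    have := hmem i (Finset.mem_range.1 hi)
    exact ⟨this.1.1.trans_lt hx'.1, hx'.2.trans this.2.2⟩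
  · have hex : ∃ i < m, x ∈ Set.Ioc (t i) (t (i + 1)) := by
      -- The least grid point at or above `x` is the right endpoint of its cell; it is not `t 0 =
      -- -N` because `x > -N`.
      have hf : ∃ j, x ≤ t j := ⟨m, htm ▸ hx.2⟩
      have hpos : Nat.find hf ≠ 0 := fun h0 => by
        have := Nat.find_spec hf
        rw [h0, ht0] at this
        exact absurd hx.1 (not_lt.2 this)
      obtain ⟨j, hj⟩ := Nat.exists_eq_succ_of_ne_zero hpos
      refine ⟨j, ?_, not_le.1 (Nat.find_min hf (by omega)), ?_⟩
      · have := Nat.find_min' hf (htm ▸ hx.2 : x ≤ t m)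
        omega
      · have := Nat.find_spec hf
        rwa [hj] at this
    obtain ⟨i, hi, hxi⟩ := hex
    have hval : φ.toFun x = h (t (i + 1)) := by
      rw [hφ]
      dsimp only
      rw [Finset.sum_eq_single i]
      · exact Set.indicator_of_mem hxi _
      · intro j _ hj
        refine Set.indicator_of_notMem (fun hxj => ?_) _
        rcases lt_or_gt_of_ne hj with h | h
        · exact absurd (hxj.2.trans (ht.monotone h)) (not_le.2 hxi.1)
        · exact absurd (hxi.2.trans (ht.monotone h)) (not_le.2 hxj.1)
      · intro h; exact absurd (Finset.mem_range.2 hi) h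
    rw [hval, ← Real.dist_eq]
    refine (hη' _ (hmem i hi).2 _ ⟨hx.1.le, hx.2⟩ ?_).le
    rw [Real.dist_eq, abs_of_nonneg (by linarith [hxi.2])]
    have : t (i + 1) - t i = 2 * N / m := by simp only [t]; push_cast; ring
    linarith [hxi.1]

/-- Functions in `L^q` restricted to `(-N, N]` are approximated in `L^q` by step functions
supported there. -/
lemma SimpleFn.exists_approx_restrict {f : ℝ → ℝ} {q : ℝ} (hq : 1 ≤ q)
    (hf : MemLp f (ENNReal.ofReal q) volume) {N : ℝ} (hN : 0 < N) {ε : ℝ≥0∞} (hε : ε ≠ 0) :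
    ∃ φ : SimpleFn, (∀ x ∉ Set.Ioc (-N) N, φ.toFun x = 0) ∧
      eLpNorm (φ.toFun - f) (ENNReal.ofReal q) (volume.restrict (Set.Ioc (-N) N)) ≤ ε := by
  set μ := (volume : Measure ℝ).restrict (Set.Ioc (-N) N)
  have hq' : 1 ≤ ENNReal.ofReal q := by simpa using hq
  obtain ⟨h, -, hfh, hh, hmem⟩ := hf.exists_hasCompactSupport_eLpNorm_sub_le
    ENNReal.ofReal_ne_top (ENNReal.half_pos hε).ne'
  -- On an interval of finite measure, a uniform error `δ` costs only a constant times `δ` in `L^q`.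
  have hlim : Tendsto (fun δ : ℝ => μ Set.univ ^ (ENNReal.ofReal q).toReal⁻¹ * ENNReal.ofReal δ)
      (𝓝[>] 0) (𝓝 0) := by
    have : Tendsto (fun δ : ℝ => μ Set.univ ^ (ENNReal.ofReal q).toReal⁻¹ * ENNReal.ofReal δ)
      (𝓝 0) (𝓝 (μ Set.univ ^ (ENNReal.ofReal q).toReal⁻¹ * ENNReal.ofReal 0)) :=
      ENNReal.Tendsto.const_mul (ENNReal.continuous_ofReal.tendsto 0)
        (Or.inr (ENNReal.rpow_ne_top_of_nonneg (by positivity) (measure_ne_top μ _)))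
    rw [ENNReal.ofReal_zero, mul_zero] at this
    exact this.mono_left nhdsWithin_le_nhds
  obtain ⟨δ, hδε, hδ⟩ := ((hlim.eventually (ge_mem_nhds (ENNReal.half_pos hε))).and
    self_mem_nhdsWithin).exists
  obtain ⟨φ, hφ0, hφ⟩ := SimpleFn.exists_approx_continuous hh hN hδ
  refine ⟨φ, hφ0, ?_⟩
  have h1 : eLpNorm (φ.toFun - h) (ENNReal.ofReal q) μ ≤ ε / 2 := by
    refine (eLpNorm_le_of_ae_bound (C := δ) ?_).trans hδε
    exact (ae_restrict_iff' measurableSet_Ioc).2 (ae_of_all _ fun x hx => hφ x hx)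
  have h2 : eLpNorm (h - f) (ENNReal.ofReal q) μ ≤ ε / 2 := by
    rw [eLpNorm_sub_comm]
    exact (eLpNorm_mono_measure _ Measure.restrict_le_self).trans hfh
  calc _ = eLpNorm ((φ.toFun - h) + (h - f)) (ENNReal.ofReal q) μ := by
        rw [sub_add_sub_cancel]
    _ ≤ _ := eLpNorm_add_le (φ.measurable_toFun.sub hh.measurable).aestronglyMeasurable
        (hh.aestronglyMeasurable.sub hf.1.restrict) hq'
    _ ≤ ε / 2 + ε / 2 := add_le_add h1 h2
    _ = ε := ENNReal.add_halves ε

/-- The tails of the `L^q` norm of a function in `L^q` vanish. -/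
lemma tendsto_eLpNorm_restrict_compl_Ioc {f : ℝ → ℝ} {q : ℝ} (hq : 0 < q)
    (hf : MemLp f (ENNReal.ofReal q) volume) :
    Tendsto (fun k : ℕ => eLpNorm f (ENNReal.ofReal q)
      (volume.restrict (Set.Ioc (-((k : ℝ) + 1)) (k + 1))ᶜ)) atTop (𝓝 0) := by
  have hq0 : ENNReal.ofReal q ≠ 0 := by simpa using hq
  simp_rw [eLpNorm_eq_lintegral_rpow_enorm_toReal hq0 ENNReal.ofReal_ne_top,
    ENNReal.toReal_ofReal hq.le]
  have hfin : ∫⁻ x, ‖f x‖ₑ ^ q ≠ ∞ := by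
    have := hf.2
    rw [eLpNorm_lt_top_iff_lintegral_rpow_enorm_lt_top hq0 ENNReal.ofReal_ne_top,
      ENNReal.toReal_ofReal hq.le] at this
    exact this.ne
  have h : Tendsto (fun k : ℕ => ∫⁻ x in (Set.Ioc (-((k : ℝ) + 1)) (k + 1))ᶜ, ‖f x‖ₑ ^ q) atTop
      (𝓝 0) := by
    have hlim := tendsto_lintegral_of_dominated_convergence' (μ := (volume : Measure ℝ))
      (F := fun (k : ℕ) x => (Set.Ioc (-((k : ℝ) + 1)) (k + 1))ᶜ.indicator
        (fun x => ‖f x‖ₑ ^ q) x) (f := fun _ => 0) (fun x => ‖f x‖ₑ ^ q)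
      (fun k => (hf.1.enorm.pow_const q).indicator measurableSet_Ioc.compl)
      (fun k => ae_of_all _ fun x => Set.indicator_le_self _ _ _) hfin
      (ae_of_all _ fun x => ?_)
    · simp_rw [lintegral_indicator measurableSet_Ioc.compl, lintegral_zero] at hlim
      exact hlim
    · obtain ⟨n, hn⟩ := exists_nat_gt |x|
      refine tendsto_const_nhds.congr' ?_
      filter_upwards [eventually_ge_atTop n] with k hk
      have hk' : (n : ℝ) ≤ k := by exact_mod_cast hk
      have := abs_lt.1 (hn.trans_le hk')
      have hx : x ∈ Set.Ioc (-((k : ℝ) + 1)) (k + 1) := ⟨by linarith, by linarith⟩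
      exact (Set.indicator_of_notMem (Set.notMem_compl_iff.2 hx) _).symm
  have := h.ennrpow_const (1 / q)
  rwa [ENNReal.zero_rpow_of_pos (by positivity)] at this

lemma eLpNorm_le_restrict_add_restrict_compl {f : ℝ → ℝ} {q : ℝ} (hq : 1 ≤ q)
    (hf : AEStronglyMeasurable f volume) {s : Set ℝ} (hs : MeasurableSet s) :
    eLpNorm f (ENNReal.ofReal q) volume ≤ eLpNorm f (ENNReal.ofReal q) (volume.restrict s) +
      eLpNorm f (ENNReal.ofReal q) (volume.restrict sᶜ) := by
  calc _ = eLpNorm (s.indicator f + sᶜ.indicator f) (ENNReal.ofReal q) volume := by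
        rw [Set.indicator_self_add_compl]
    _ ≤ _ := eLpNorm_add_le (hf.indicator hs) (hf.indicator hs.compl) (by simpa using hq)
    _ = _ := by rw [eLpNorm_indicator_eq_eLpNorm_restrict hs,
        eLpNorm_indicator_eq_eLpNorm_restrict hs.compl]

/-- Step functions approximate `f ∈ L^q`, and do so simultaneously in `L^1` if `f ∈ L^1`. -/
lemma SimpleFn.exists_seq_tendsto {f : ℝ → ℝ} {q : ℝ} (hq : 1 ≤ q)
    (hf : MemLp f (ENNReal.ofReal q) volume) : ∃ φ : ℕ → SimpleFn,
      Tendsto (fun n => eLpNorm ((φ n).toFun - f) (ENNReal.ofReal q) volume) atTop (𝓝 0) ∧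
      (MemLp f 1 volume →
        Tendsto (fun n => eLpNorm ((φ n).toFun - f) 1 volume) atTop (𝓝 0)) := by
  let I : ℕ → Set ℝ := fun k => Set.Ioc (-((k : ℝ) + 1)) (k + 1)
  -- The Hölder constant bounding the `L^1` norm by the `L^q` norm on `I k`; it may grow with `k`.
  let c : ℕ → ℝ≥0∞ := fun k => volume (I k) ^ (1 / (ENNReal.ofReal 1).toReal -
    1 / (ENNReal.ofReal q).toReal)
  have hc : ∀ k, c k ≠ ∞ := fun k => by
    refine ENNReal.rpow_ne_top_of_nonneg ?_ (by simp [I])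
    rw [ENNReal.toReal_ofReal zero_le_one, ENNReal.toReal_ofReal (by linarith), sub_nonneg]
    exact one_div_le_one_div_of_le one_pos hq
  -- Dividing by `1 + c k` keeps both the `L^q` error and the `L^1` error on `I k` below `1 / (k +
  -- 1)`.
  let ε : ℕ → ℝ≥0∞ := fun k => ((k : ℝ≥0∞) + 1)⁻¹ / (1 + c k)
  have hε : ∀ k, ε k ≠ 0 := fun k => by
    refine (ENNReal.div_pos (by simp) ?_).ne'
    exact ENNReal.add_ne_top.2 ⟨ENNReal.one_ne_top, hc k⟩
  choose φ hφ0 hφ using fun k : ℕ => SimpleFn.exists_approx_restrict hq hf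
    (N := (k : ℝ) + 1) (by positivity) (hε k)
  have hb : ∀ k, (1 + c k) * ε k ≤ ((k : ℝ≥0∞) + 1)⁻¹ := fun k => ENNReal.mul_div_le
  have hinv : Tendsto (fun k : ℕ => ((k : ℝ≥0∞) + 1)⁻¹) atTop (𝓝 0) := by
    have := (tendsto_add_atTop_iff_nat 1).2 ENNReal.tendsto_inv_nat_nhds_zero
    simpa using this
  have hmeas : ∀ k, AEStronglyMeasurable ((φ k).toFun - f) volume := fun k =>
    (φ k).measurable_toFun.aestronglyMeasurable.sub hf.1
  have hout : ∀ k (r : ℝ≥0∞), eLpNorm ((φ k).toFun - f) r (volume.restrict (I k)ᶜ) =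
      eLpNorm f r (volume.restrict (I k)ᶜ) := fun k r => by
    rw [← eLpNorm_neg]
    refine eLpNorm_congr_ae ((ae_restrict_iff' measurableSet_Ioc.compl).2
      (ae_of_all _ fun x hx => ?_))
    simp [hφ0 k x hx]
  have key : ∀ r : ℝ, 1 ≤ r → MemLp f (ENNReal.ofReal r) volume →
      (∀ k, eLpNorm ((φ k).toFun - f) (ENNReal.ofReal r) (volume.restrict (I k)) ≤
        (1 + c k) * ε k) →
      Tendsto (fun n => eLpNorm ((φ n).toFun - f) (ENNReal.ofReal r) volume) atTop (𝓝 0) := by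
    intro r hr hfr h
    have hsum := hinv.add (tendsto_eLpNorm_restrict_compl_Ioc (by linarith) hfr)
    rw [add_zero] at hsum
    refine tendsto_of_tendsto_of_tendsto_of_le_of_le tendsto_const_nhds hsum
      (fun _ => zero_le) fun k => ?_
    refine (eLpNorm_le_restrict_add_restrict_compl hr (hmeas k) measurableSet_Ioc).trans
      (add_le_add ((h k).trans (hb k)) (hout k _).le)
  refine ⟨φ, key q hq hf fun k => (hφ k).trans ?_, fun h1 => ?_⟩
  · exact le_mul_of_one_le_left zero_le le_self_add
  · rw [← ENNReal.ofReal_one] at h1 ⊢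
    refine key 1 le_rfl h1 fun k => ?_
    refine (eLpNorm_le_eLpNorm_mul_rpow_measure_univ (ENNReal.ofReal_le_ofReal hq)
      (hmeas k).restrict).trans ?_
    rw [Measure.restrict_apply_univ, mul_comm]
    gcongr
    · exact le_add_self
    · exact hφ k

/-! ### Limits in `L^q` -/

section

variable {X : Type*} [MeasurableSpace X] {μ : Measure X} {q : ℝ≥0∞}

lemma tendsto_eLpNorm_of_tendsto_sub (hq : 1 ≤ q) {u : ℕ → X → ℝ} {v : X → ℝ}
    (hu : ∀ n, AEStronglyMeasurable (u n) μ) (hv : MemLp v q μ)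
    (h : Tendsto (fun n => eLpNorm (u n - v) q μ) atTop (𝓝 0)) :
    Tendsto (fun n => eLpNorm (u n) q μ) atTop (𝓝 (eLpNorm v q μ)) := by
  have h1 : Tendsto (fun n => eLpNorm v q μ - eLpNorm (u n - v) q μ) atTop
      (𝓝 (eLpNorm v q μ)) := by
    simpa using ENNReal.Tendsto.sub tendsto_const_nhds h (Or.inl hv.2.ne)
  have h2 : Tendsto (fun n => eLpNorm v q μ + eLpNorm (u n - v) q μ) atTop
      (𝓝 (eLpNorm v q μ)) := by
    simpa using tendsto_const_nhds.add h
  refine tendsto_of_tendsto_of_tendsto_of_le_of_le h1 h2 (fun n => ?_) (fun n => ?_)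
  · refine tsub_le_iff_right.2 ?_
    have := eLpNorm_sub_le (hu n) ((hu n).sub hv.1) hq
    rwa [sub_sub_cancel] at this
  · have := eLpNorm_add_le hv.1 ((hu n).sub hv.1) hq
    rwa [add_sub_cancel] at this

lemma tendsto_eLpNorm_add_smul_sub (hq : 1 ≤ q) {u w : ℕ → X → ℝ} {v z : X → ℝ}
    (hu : ∀ n, AEStronglyMeasurable (u n - v) μ) (hw : ∀ n, AEStronglyMeasurable (w n - z) μ)
    (h : Tendsto (fun n => eLpNorm (u n - v) q μ) atTop (𝓝 0))
    (h' : Tendsto (fun n => eLpNorm (w n - z) q μ) atTop (𝓝 0)) (c : ℝ) :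
    Tendsto (fun n => eLpNorm ((u n + c • w n) - (v + c • z)) q μ) atTop (𝓝 0) := by
  have hlim := h.add (ENNReal.Tendsto.const_mul (a := ‖c‖ₑ) h' (Or.inr enorm_ne_top))
  rw [mul_zero, add_zero] at hlim
  refine tendsto_of_tendsto_of_tendsto_of_le_of_le tendsto_const_nhds hlim
    (fun _ => zero_le) fun n => ?_
  rw [show u n + c • w n - (v + c • z) = (u n - v) + c • (w n - z) by module]
  refine (eLpNorm_add_le (hu n) ((hw n).const_smul c) hq).trans ?_
  rw [eLpNorm_const_smul]

lemma ae_eq_of_tendsto_eLpNorm (hq : 1 ≤ q) {u : ℕ → X → ℝ} {v w : X → ℝ}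
    (hu : ∀ n, AEStronglyMeasurable (u n) μ) (hv : AEStronglyMeasurable v μ)
    (hw : AEStronglyMeasurable w μ)
    (h : Tendsto (fun n => eLpNorm (u n - v) q μ) atTop (𝓝 0))
    (h' : Tendsto (fun n => eLpNorm (u n - w) q μ) atTop (𝓝 0)) : v =ᵐ[μ] w :=
  have hq0 : q ≠ 0 := (zero_lt_one.trans_le hq).ne'
  tendstoInMeasure_ae_unique (tendstoInMeasure_of_tendsto_eLpNorm hq0 hu hv h)
    (tendstoInMeasure_of_tendsto_eLpNorm hq0 hu hw h')

end

/-! ### The stable integral on `L^α(ℝ)` -/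

/-- `(f, Y)` lies in the closure in `L^α(ℝ) × L^p(Ω)` of the set of all pairs `(φ, ∫ φ dL)` with
`φ` simple. -/
def HasStableIntegral {Ω : Type*} [MeasurableSpace Ω] (P : Measure Ω) (α p : ℝ)
    (L : ℝ → Ω → ℝ) (f : ℝ → ℝ) (Y : Ω → ℝ) : Prop :=
  MemLp f (ENNReal.ofReal α) volume ∧ MemLp Y (ENNReal.ofReal p) P ∧ ∃ φ : ℕ → SimpleFn,
    Tendsto (fun n => eLpNorm ((φ n).toFun - f) (ENNReal.ofReal α) volume) atTop (𝓝 0) ∧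
    Tendsto (fun n => eLpNorm ((φ n).integral L - Y) (ENNReal.ofReal p) P) atTop (𝓝 0)

section

variable {Ω : Type*} [MeasurableSpace Ω] {P : Measure Ω} {α p : ℝ} {L : ℝ → Ω → ℝ}
  {f g : ℝ → ℝ} {Y Z : Ω → ℝ}

lemma HasStableIntegral.congr_left (h : HasStableIntegral P α p L f Y) (hfg : f =ᵐ[volume] g) :
    HasStableIntegral P α p L g Y := by
  obtain ⟨h1, h2, φ, h3, h4⟩ := h
  refine ⟨h1.ae_eq hfg, h2, φ, h3.congr fun n => eLpNorm_congr_ae ?_, h4⟩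
  exact EventuallyEq.rfl.sub hfg

lemma HasStableIntegral.add_smul (hα : 1 ≤ α) (hp : 1 ≤ p) (hL : ∀ t, AEMeasurable (L t) P)
    (h : HasStableIntegral P α p L f Y) (h' : HasStableIntegral P α p L g Z) (c : ℝ) :
    HasStableIntegral P α p L (f + c • g) (Y + c • Z) := by
  obtain ⟨h1, h2, φ, h3, h4⟩ := h
  obtain ⟨h1', h2', ψ, h3', h4'⟩ := h'
  choose χ hχ hχ' using fun n => SimpleFn.exists_add_smul L (φ n) (ψ n) c
  refine ⟨h1.add (h1'.const_smul c), h2.add (h2'.const_smul c), χ, ?_, ?_⟩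
  · simp_rw [hχ]
    exact tendsto_eLpNorm_add_smul_sub (by simpa using hα)
      (fun n => (φ n).measurable_toFun.aestronglyMeasurable.sub h1.1)
      (fun n => (ψ n).measurable_toFun.aestronglyMeasurable.sub h1'.1) h3 h3' c
  · simp_rw [hχ']
    exact tendsto_eLpNorm_add_smul_sub (by simpa using hp)
      (fun n => ((φ n).aemeasurable_integral hL).aestronglyMeasurable.sub h2.1)
      (fun n => ((ψ n).aemeasurable_integral hL).aestronglyMeasurable.sub h2'.1) h4 h4' c

lemma HasStableIntegral.sub (hα : 1 ≤ α) (hp : 1 ≤ p) (hL : ∀ t, AEMeasurable (L t) P)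
    (h : HasStableIntegral P α p L f Y) (h' : HasStableIntegral P α p L g Z) :
    HasStableIntegral P α p L (f - g) (Y - Z) := by
  simpa [sub_eq_add_neg] using h.add_smul hα hp hL h' (-1)

variable [IsProbabilityMeasure P]

lemma IsStableMotion.hasStableIntegral_toFun (hL : IsStableMotion P α L) (hp : 0 < p)
    (hpα : p < α) (φ : SimpleFn) : HasStableIntegral P α p L φ.toFun (φ.integral L) :=
  ⟨φ.memLp_toFun (hp.trans hpα), hL.memLp_integral hp hpα φ, fun _ => φ, by simp, by simp⟩

lemma IsStableMotion.hasStableIntegral_zero (hL : IsStableMotion P α L) (hp : 0 < p)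
    (hpα : p < α) : HasStableIntegral P α p L 0 0 := by
  let φ : SimpleFn := ⟨0, 0, fun i => (i : ℕ), fun _ _ h => Nat.cast_lt.2 h⟩
  have h1 : φ.toFun = 0 := by
    ext; simp [SimpleFn.toFun, φ]
  have h2 : φ.integral L = 0 := by
    ext; simp [SimpleFn.integral, φ]
  simpa only [h1, h2] using hL.hasStableIntegral_toFun hp hpα φ

/-- The stable stochastic integral is a multiple of an isometry from `L^α(ℝ)` to `L^p(Ω)`. -/
lemma HasStableIntegral.eLpNorm_eq (h : HasStableIntegral P α p L f Y)
    (hL : IsStableMotion P α L) (hp : 1 ≤ p) (hpα : p < α) :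
    eLpNorm Y (ENNReal.ofReal p) P =
      eLpNorm (L 1) (ENNReal.ofReal p) P * eLpNorm f (ENNReal.ofReal α) volume := by
  obtain ⟨h1, h2, φ, h3, h4⟩ := h
  have hp0 : 0 < p := zero_lt_one.trans_le hp
  have e1 := tendsto_eLpNorm_of_tendsto_sub (by simpa using hp)
    (fun n => ((φ n).aemeasurable_integral hL.aemeasurable).aestronglyMeasurable) h2 h4
  have e2 := tendsto_eLpNorm_of_tendsto_sub (by simpa using (hp.trans hpα.le))
    (fun n => (φ n).measurable_toFun.aestronglyMeasurable) h1 h3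
  simp_rw [hL.eLpNorm_integral (hp0.trans hpα)] at e1
  exact tendsto_nhds_unique e1
    (ENNReal.Tendsto.const_mul e2 (Or.inr (hL.memLp_one hp0 hpα).2.ne))

/-- The pair `(φ n - f, ∫ φ n dL - Y)` again lies in the closure, so the isometry converts one error
into the other. Hence the limit does not depend on the sequence. -/
lemma IsStableMotion.tendsto_integral (hL : IsStableMotion P α L) (hp : 1 ≤ p) (hpα : p < α)
    (h : HasStableIntegral P α p L f Y) {φ : ℕ → SimpleFn}
    (hφ : Tendsto (fun n => eLpNorm ((φ n).toFun - f) (ENNReal.ofReal α) volume) atTop (𝓝 0)) :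
    Tendsto (fun n => eLpNorm ((φ n).integral L - Y) (ENNReal.ofReal p) P) atTop (𝓝 0) := by
  have hp0 : 0 < p := zero_lt_one.trans_le hp
  have heq : ∀ n, eLpNorm ((φ n).integral L - Y) (ENNReal.ofReal p) P = _ := fun n =>
    ((hL.hasStableIntegral_toFun hp0 hpα (φ n)).sub (hp.trans hpα.le) hp
      hL.aemeasurable h).eLpNorm_eq hL hp hpα
  simp_rw [heq]
  simpa using ENNReal.Tendsto.const_mul hφ (Or.inr (hL.memLp_one hp0 hpα).2.ne)

lemma IsStableMotion.exists_hasStableIntegral (hL : IsStableMotion P α L) (hp : 1 ≤ p)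
    (hpα : p < α) (hf : MemLp f (ENNReal.ofReal α) volume) :
    ∃ Y, HasStableIntegral P α p L f Y := by
  have hp0 : 0 < p := zero_lt_one.trans_le hp
  have hα : 1 ≤ α := hp.trans hpα.le
  obtain ⟨φ, hφ, -⟩ := SimpleFn.exists_seq_tendsto hα hf
  set C := eLpNorm (L 1) (ENNReal.ofReal p) P
  have hC : C ≠ ∞ := (hL.memLp_one hp0 hpα).2.ne
  -- The completeness criterion used below needs summable bounds, hence a subsequence with geometric
  -- errors.
  let B : ℕ → ℝ≥0∞ := fun n => (2⁻¹ : ℝ≥0∞) ^ n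
  have hB : ∀ n, 0 < B n := fun n => ENNReal.pow_pos (by simp) n
  have hsmall : ∀ N, ∀ᶠ n in atTop,
      C * eLpNorm ((φ n).toFun - f) (ENNReal.ofReal α) volume < B N / 2 := fun N => by
    have := ENNReal.Tendsto.const_mul hφ (Or.inr hC)
    rw [mul_zero] at this
    exact this.eventually (gt_mem_nhds (ENNReal.half_pos (hB N).ne'))
  choose M hM using fun N => eventually_atTop.1 (hsmall N)
  -- The sum dominates every threshold `M j` with `j ≤ N`, and the summand `N` forces `k` to
  -- infinity.
  let k : ℕ → ℕ := fun N => N + ∑ j ∈ Finset.range (N + 1), M j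
  have hkM : ∀ N n, N ≤ n → M N ≤ k n := fun N n hn => by
    have : M N ≤ ∑ j ∈ Finset.range (n + 1), M j :=
      Finset.single_le_sum (f := M) (fun _ _ => Nat.zero_le _)
        (Finset.mem_range.2 (Nat.lt_succ_of_le hn))
    exact this.trans (Nat.le_add_left _ _)
  have hk : Tendsto k atTop atTop :=
    tendsto_atTop_mono (fun n => Nat.le_add_right _ _) tendsto_id
  obtain ⟨Y, hY, hlim⟩ := Lp.cauchy_complete_eLpNorm (p := ENNReal.ofReal p) (μ := P)
    (f := fun n => (φ (k n)).integral L) (B := B) (by simpa using hp)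
    (fun n => hL.memLp_integral hp0 hpα _)
    (by simp only [B, ENNReal.tsum_geometric]; norm_num) (fun N n m hn hm => by
      have h1 := ((hL.hasStableIntegral_toFun hp0 hpα (φ (k n))).sub hα hp hL.aemeasurable
        (hL.hasStableIntegral_toFun hp0 hpα (φ (k m)))).eLpNorm_eq hL hp hpα
      rw [h1]
      have h2 : eLpNorm ((φ (k n)).toFun - (φ (k m)).toFun) (ENNReal.ofReal α) volume ≤
          eLpNorm ((φ (k n)).toFun - f) (ENNReal.ofReal α) volume +
          eLpNorm ((φ (k m)).toFun - f) (ENNReal.ofReal α) volume := by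
        rw [← sub_sub_sub_cancel_right _ _ f]
        exact eLpNorm_sub_le ((φ _).measurable_toFun.aestronglyMeasurable.sub hf.1)
          ((φ _).measurable_toFun.aestronglyMeasurable.sub hf.1) (by simpa using hα)
      calc _ ≤ C * _ := mul_le_mul' le_rfl h2
        _ < B N / 2 + B N / 2 := by
          rw [mul_add]
          exact ENNReal.add_lt_add (hM N _ (hkM N n hn)) (hM N _ (hkM N m hm))
        _ = B N := ENNReal.add_halves _)
  exact ⟨Y, hf, hY, fun n => φ (k n), hφ.comp hk, hlim⟩

lemma HasStableIntegral.isStableIntegral (h : HasStableIntegral P α p L f Y)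
    (hL : IsStableMotion P α L) (hp : 1 ≤ p) (hpα : p < α) : IsStableIntegral P α L f Y := by
  obtain ⟨φ, hφ, -⟩ := h.2.2
  refine ⟨h.1, h.2.1.1.aemeasurable, ⟨φ, hφ⟩, fun ψ hψ => ?_⟩
  exact tendstoInMeasure_of_tendsto_eLpNorm (by simpa using zero_lt_one.trans_le hp)
    (fun n => ((ψ n).aemeasurable_integral hL.aemeasurable).aestronglyMeasurable) h.2.1.1
    (hL.tendsto_integral hp hpα h hψ)

/-- Limits in probability are unique, so `Y` agrees almost surely with the `L^p` limit and inherits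
its finite `p`-th moment and the convergence in `L^p`. -/
lemma IsStableIntegral.hasStableIntegral (h : IsStableIntegral P α L f Y)
    (hL : IsStableMotion P α L) (hp : 1 ≤ p) (hpα : p < α) : HasStableIntegral P α p L f Y := by
  obtain ⟨Z, hZ⟩ := hL.exists_hasStableIntegral hp hpα h.1
  obtain ⟨φ, hφ⟩ := h.2.2.1
  have hZY : Z =ᵐ[P] Y := tendstoInMeasure_ae_unique
    ((hZ.isStableIntegral hL hp hpα).2.2.2 φ hφ) (h.2.2.2 φ hφ)
  refine ⟨h.1, hZ.2.1.ae_eq hZY, φ, hφ,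
    (hL.tendsto_integral hp hpα hZ hφ).congr fun n => eLpNorm_congr_ae ?_⟩
  exact EventuallyEq.rfl.sub hZY

lemma IsStableMotion.isStableIntegral_stableIntegral (hL : IsStableMotion P α L) (hp : 1 ≤ p)
    (hpα : p < α) (hf : MemLp f (ENNReal.ofReal α) volume) :
    IsStableIntegral P α L f (stableIntegral P α L f) := by
  have h : ∃ Y, IsStableIntegral P α L f Y := by
    obtain ⟨Y, hY⟩ := hL.exists_hasStableIntegral hp hpα hf
    exact ⟨Y, hY.isStableIntegral hL hp hpα⟩
  rw [stableIntegral, dif_pos h]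
  exact h.choose_spec

end

/-! ### Boundedness of the fractional integral -/

/-- Minkowski's integral inequality for a kernel whose sections have bounded `L^q` norm. -/
lemma lintegral_rpow_lintegral_mul_le {X S : Type*} [MeasurableSpace X] [MeasurableSpace S]
    {μ : Measure X} {ν : Measure S} [SFinite μ] [SFinite ν] {q : ℝ} (hq : 1 < q)
    {K : X → S → ℝ≥0∞} (hK : Measurable (Function.uncurry K)) {w : S → ℝ≥0∞} (hw : Measurable w)
    {C : ℝ≥0∞} (hC : ∀ s, ∫⁻ x, K x s ^ q ∂μ ≤ C) :
    (∫⁻ x, (∫⁻ s, K x s * w s ∂ν) ^ q ∂μ) ^ (1 / q) ≤ (∫⁻ s, w s ∂ν) * C ^ (1 / q) := by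
  have hq0 : 0 < q := by linarith
  have hc := Real.HolderConjugate.conjExponent hq
  set q' := q.conjExponent
  set W := ∫⁻ s, w s ∂ν
  have hsum : 1 / q + 1 / q' = 1 := by simpa using hc.inv_add_inv_eq_one
  have hexp : 1 / q' * q = q - 1 := by
    rw [← eq_sub_iff_add_eq'] at hsum
    rw [hsum]; field_simp
  -- Hölder with respect to `ν`, after splitting the weight as `w = w ^ (1/q) * w ^ (1/q')`.
  have hpt : ∀ x, (∫⁻ s, K x s * w s ∂ν) ^ q ≤ (∫⁻ s, K x s ^ q * w s ∂ν) * W ^ (q - 1) := by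
    intro x
    have hKx : Measurable (K x) := hK.comp measurable_prodMk_left
    have h := ENNReal.lintegral_mul_le_Lp_mul_Lq ν hc (f := fun s => K x s * w s ^ (1 / q))
      (g := fun s => w s ^ (1 / q')) (hKx.mul (hw.pow_const _)).aemeasurable
      (hw.pow_const _).aemeasurable
    have e1 : ∀ s, ((fun s => K x s * w s ^ (1 / q)) * fun s => w s ^ (1 / q')) s =
        K x s * w s := fun s => by
      rw [Pi.mul_apply, mul_assoc, ← ENNReal.rpow_add_of_nonneg _ _ (by positivity)
        (one_div_nonneg.2 hc.symm.nonneg), hsum, ENNReal.rpow_one]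
    have e2 : ∀ s, (K x s * w s ^ (1 / q)) ^ q = K x s ^ q * w s := fun s => by
      rw [ENNReal.mul_rpow_of_nonneg _ _ hq0.le, ← ENNReal.rpow_mul, one_div_mul_cancel hq0.ne',
        ENNReal.rpow_one]
    have e3 : ∀ s, (w s ^ (1 / q')) ^ q' = w s := fun s => by
      rw [← ENNReal.rpow_mul, one_div_mul_cancel hc.symm.ne_zero, ENNReal.rpow_one]
    simp_rw [e1, e2, e3] at h
    calc _ ≤ ((∫⁻ s, K x s ^ q * w s ∂ν) ^ (1 / q) * W ^ (1 / q')) ^ q := by gcongr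
      _ = _ := by
        rw [ENNReal.mul_rpow_of_nonneg _ _ hq0.le, ← ENNReal.rpow_mul, ← ENNReal.rpow_mul,
          one_div_mul_cancel hq0.ne', ENNReal.rpow_one, hexp]
  -- Tonelli brings in the uniform bound on the sections.
  have hswap : ∫⁻ x, ∫⁻ s, K x s ^ q * w s ∂ν ∂μ ≤ C * W := by
    have hm : Measurable (Function.uncurry fun x s => K x s ^ q * w s) :=
      (hK.pow_const q).mul (hw.comp measurable_snd)
    rw [lintegral_lintegral_swap hm.aemeasurable, ← lintegral_const_mul _ hw]
    refine lintegral_mono fun s => ?_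
    have hKs : Measurable fun x => K x s := hK.comp measurable_prodMk_right
    rw [lintegral_mul_const _ (hKs.pow_const q)]
    exact mul_le_mul' (hC s) le_rfl
  have htot : ∫⁻ x, (∫⁻ s, K x s * w s ∂ν) ^ q ∂μ ≤ C * W ^ q := by
    calc _ ≤ ∫⁻ x, (∫⁻ s, K x s ^ q * w s ∂ν) * W ^ (q - 1) ∂μ := lintegral_mono hpt
      _ = (∫⁻ x, ∫⁻ s, K x s ^ q * w s ∂ν ∂μ) * W ^ (q - 1) := by
        refine lintegral_mul_const _ ?_
        exact Measurable.lintegral_prod_right ((hK.pow_const q).mul (hw.comp measurable_snd))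
      _ ≤ C * W * W ^ (q - 1) := mul_le_mul' hswap le_rfl
      _ = C * W ^ q := by
        rw [mul_assoc]
        congr 1
        nth_rewrite 1 [← ENNReal.rpow_one W]
        rw [← ENNReal.rpow_add_of_nonneg _ _ zero_le_one (by linarith), add_sub_cancel]
  calc _ ≤ (C * W ^ q) ^ (1 / q) := by gcongr
    _ = _ := by
      rw [ENNReal.mul_rpow_of_nonneg _ _ (by positivity), ← ENNReal.rpow_mul,
        mul_one_div_cancel hq0.ne', ENNReal.rpow_one, mul_comm]

/-- The Riemann–Liouville kernel `s ↦ s^{d-1}`, cut off to a set of positive numbers. -/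
noncomputable def rlKernel (d : ℝ) (A : Set ℝ) (s : ℝ) : ℝ≥0∞ :=
  A.indicator (fun s => ENNReal.ofReal (s ^ (d - 1))) s

lemma measurable_rlKernel (d : ℝ) {A : Set ℝ} (hA : MeasurableSet A) :
    Measurable (rlKernel d A) :=
  Measurable.indicator (by fun_prop) hA

lemma lintegral_rlKernel_Ioc_ne_top {d : ℝ} (hd : 0 < d) :
    ∫⁻ s, rlKernel d (Set.Ioc 0 1) s ≠ ∞ := by
  unfold rlKernel
  rw [lintegral_indicator measurableSet_Ioc]
  have hi : IntegrableOn (fun t : ℝ => t ^ (d - 1)) (Set.Ioc 0 1) :=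
    (intervalIntegrable_iff_integrableOn_Ioc_of_le zero_le_one).1
      (intervalIntegral.intervalIntegrable_rpow' (by linarith))
  exact hi.lintegral_lt_top.ne

lemma lintegral_rlKernel_Ioi_rpow_ne_top {d q : ℝ} (hq : 0 < q) (hd : (d - 1) * q < -1) :
    ∫⁻ s, rlKernel d (Set.Ioi 1) s ^ q ≠ ∞ := by
  have h : ∀ s, rlKernel d (Set.Ioi 1) s ^ q =
      (Set.Ioi (1 : ℝ)).indicator (fun s => ENNReal.ofReal (s ^ ((d - 1) * q))) s := by
    intro s
    by_cases hs : s ∈ Set.Ioi (1 : ℝ)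
    · have hs0 : (0 : ℝ) ≤ s := zero_le_one.trans (le_of_lt hs)
      rw [rlKernel, Set.indicator_of_mem hs, Set.indicator_of_mem hs,
        ENNReal.ofReal_rpow_of_nonneg (by positivity) hq.le, ← Real.rpow_mul hs0]
    · rw [rlKernel, Set.indicator_of_notMem hs, Set.indicator_of_notMem hs,
        ENNReal.zero_rpow_of_pos hq]
  simp_rw [h]
  rw [lintegral_indicator measurableSet_Ioi]
  exact (integrableOn_Ioi_rpow_of_lt hd zero_lt_one).lintegral_lt_top.ne

/-- The potential `∫_x^∞ |f(t)| (t - x)^{d-1} dt`. -/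
noncomputable def rlPotential (d : ℝ) (A : Set ℝ) (f : ℝ → ℝ) (x : ℝ) : ℝ≥0∞ :=
  ∫⁻ t, rlKernel d A (t - x) * ‖f t‖ₑ

lemma measurable_rlPotential (d : ℝ) {A : Set ℝ} (hA : MeasurableSet A) {f : ℝ → ℝ}
    (hf : Measurable f) : Measurable (rlPotential d A f) := by
  refine Measurable.lintegral_prod_right (f := fun x t => rlKernel d A (t - x) * ‖f t‖ₑ) ?_
  exact ((measurable_rlKernel d hA).comp (measurable_snd.sub measurable_fst)).mul
    (hf.comp measurable_snd).enorm

lemma rlPotential_Ioi_zero (d : ℝ) {f : ℝ → ℝ} (hf : Measurable f) (x : ℝ) :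
    rlPotential d (Set.Ioi 0) f x =
      rlPotential d (Set.Ioc 0 1) f x + rlPotential d (Set.Ioi 1) f x := by
  have hk : ∀ s, rlKernel d (Set.Ioi 0) s =
      rlKernel d (Set.Ioc 0 1) s + rlKernel d (Set.Ioi 1) s := fun s => by
    unfold rlKernel
    rw [← Set.Ioc_union_Ioi_eq_Ioi (zero_le_one (α := ℝ)), Set.indicator_union_of_disjoint
      Set.Ioc_disjoint_Ioi_same]
  unfold rlPotential
  simp_rw [hk, add_mul]
  refine lintegral_add_left ?_ _
  exact ((measurable_rlKernel d measurableSet_Ioc).comp (measurable_id.sub_const x)).mul hf.enorm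

/-- Near part: the kernel is the integrable weight, and Minkowski is applied to the translates of
`f`, whose `L^q` norms all agree. -/
lemma rlPotential_Ioc_le {d q : ℝ} (hq : 1 < q) {f : ℝ → ℝ} (hf : Measurable f) :
    (∫⁻ x, rlPotential d (Set.Ioc 0 1) f x ^ q) ^ (1 / q) ≤
      (∫⁻ s, rlKernel d (Set.Ioc 0 1) s) * (∫⁻ x, ‖f x‖ₑ ^ q) ^ (1 / q) := by
  have h := lintegral_rpow_lintegral_mul_le (μ := volume) (ν := volume) hq
    (K := fun x s => ‖f (s + x)‖ₑ) (w := rlKernel d (Set.Ioc 0 1))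
    (hf.comp (measurable_snd.add measurable_fst)).enorm
    (measurable_rlKernel d measurableSet_Ioc) (C := ∫⁻ x, ‖f x‖ₑ ^ q)
    (fun s => (lintegral_add_left_eq_self (fun x => ‖f x‖ₑ ^ q) s).le)
  convert h using 5 with x
  rw [rlPotential, ← lintegral_add_right_eq_self _ x]
  simp_rw [add_sub_cancel_right, mul_comm]

/-- Far part: the roles are exchanged, with `|f|` as the weight and reflected translates of the
kernel measured in `L^q`. -/
lemma rlPotential_Ioi_le {d q : ℝ} (hq : 1 < q) {f : ℝ → ℝ} (hf : Measurable f) :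
    (∫⁻ x, rlPotential d (Set.Ioi 1) f x ^ q) ^ (1 / q) ≤
      (∫⁻ t, ‖f t‖ₑ) * (∫⁻ s, rlKernel d (Set.Ioi 1) s ^ q) ^ (1 / q) :=
  lintegral_rpow_lintegral_mul_le (μ := volume) (ν := volume) hq
    (K := fun x t => rlKernel d (Set.Ioi 1) (t - x)) (w := fun t => ‖f t‖ₑ)
    ((measurable_rlKernel d measurableSet_Ioi).comp (measurable_snd.sub measurable_fst))
    hf.enorm (C := ∫⁻ s, rlKernel d (Set.Ioi 1) s ^ q)
    (fun t => (lintegral_sub_left_eq_self (fun s => rlKernel d (Set.Ioi 1) s ^ q) t).le)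

lemma exists_rlPotential_le {d q : ℝ} (hd : 0 < d) (hq : 1 < q) (hdq : (d - 1) * q < -1) :
    ∃ C : ℝ≥0∞, C ≠ ∞ ∧ ∀ f : ℝ → ℝ, Measurable f →
      (∫⁻ x, rlPotential d (Set.Ioi 0) f x ^ q) ^ (1 / q) ≤
        C * (eLpNorm f (ENNReal.ofReal q) volume + eLpNorm f 1 volume) := by
  have hq0 : 0 < q := by linarith
  set C₀ := ∫⁻ s, rlKernel d (Set.Ioc 0 1) s
  set C₁ := (∫⁻ s, rlKernel d (Set.Ioi 1) s ^ q) ^ (1 / q)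
  refine ⟨C₀ + C₁, ENNReal.add_ne_top.2 ⟨lintegral_rlKernel_Ioc_ne_top hd,
    ENNReal.rpow_ne_top_of_nonneg (by positivity)
      (lintegral_rlKernel_Ioi_rpow_ne_top hq0 hdq)⟩, fun f hf => ?_⟩
  simp_rw [rlPotential_Ioi_zero d hf]
  refine (ENNReal.lintegral_Lp_add_le (measurable_rlPotential d measurableSet_Ioc hf).aemeasurable
    (measurable_rlPotential d measurableSet_Ioi hf).aemeasurable hq.le).trans ?_
  rw [eLpNorm_one_eq_lintegral_enorm, eLpNorm_eq_lintegral_rpow_enorm_toReal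
    (by simpa using hq0) ENNReal.ofReal_ne_top, ENNReal.toReal_ofReal hq0.le]
  refine (add_le_add (rlPotential_Ioc_le hq hf) (rlPotential_Ioi_le hq hf)).trans ?_
  rw [mul_comm (∫⁻ t, ‖f t‖ₑ), add_mul]
  gcongr
  · exact le_self_add
  · exact le_add_self

lemma enorm_mul_rpow_eq (d : ℝ) (f : ℝ → ℝ) (x t : ℝ) (ht : t ∈ Set.Ioi x) :
    ‖f t * (t - x) ^ (d - 1)‖ₑ = rlKernel d (Set.Ioi 0) (t - x) * ‖f t‖ₑ := by
  have h : t - x ∈ Set.Ioi (0 : ℝ) := Set.mem_Ioi.2 (sub_pos.2 ht)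
  rw [rlKernel, Set.indicator_of_mem h, enorm_mul, mul_comm,
    Real.enorm_eq_ofReal (Real.rpow_nonneg (le_of_lt h) _)]

lemma setLIntegral_enorm_eq_rlPotential (d : ℝ) (f : ℝ → ℝ) (x : ℝ) :
    ∫⁻ t in Set.Ioi x, ‖f t * (t - x) ^ (d - 1)‖ₑ = rlPotential d (Set.Ioi 0) f x := by
  rw [setLIntegral_congr_fun measurableSet_Ioi (enorm_mul_rpow_eq d f x), rlPotential,
    ← lintegral_indicator measurableSet_Ioi]
  refine lintegral_congr fun t => ?_
  by_cases ht : t ∈ Set.Ioi x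
  · rw [Set.indicator_of_mem ht]
  · have : t - x ∉ Set.Ioi (0 : ℝ) := fun h => ht (Set.mem_Ioi.2 (sub_pos.1 h))
    rw [Set.indicator_of_notMem ht, rlKernel, Set.indicator_of_notMem this, zero_mul]

lemma fracIntegral_congr_ae (d : ℝ) {f g : ℝ → ℝ} (h : f =ᵐ[volume] g) :
    fracIntegral d f = fracIntegral d g := by
  ext x
  unfold fracIntegral
  congr 1
  refine integral_congr_ae (ae_restrict_of_ae ?_)
  filter_upwards [h] with t ht
  rw [ht]

lemma measurable_fracIntegral (d : ℝ) {f : ℝ → ℝ} (hf : Measurable f) :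
    Measurable (fracIntegral d f) := by
  unfold fracIntegral
  refine Measurable.const_mul ?_ _
  have hm : Measurable fun z : ℝ × ℝ =>
      {z : ℝ × ℝ | z.1 < z.2}.indicator (fun z => f z.2 * (z.2 - z.1) ^ (d - 1)) z :=
    ((hf.comp measurable_snd).mul ((measurable_snd.sub measurable_fst).pow_const _)).indicator
      (measurableSet_lt measurable_fst measurable_snd)
  have h := (hm.stronglyMeasurable.integral_prod_right' (ν := volume)).measurable
  convert h using 2 with x
  rw [← integral_indicator measurableSet_Ioi]
  rfl

lemma enorm_fracIntegral_le (d : ℝ) (f : ℝ → ℝ) (x : ℝ) :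
    ‖fracIntegral d f x‖ₑ ≤ ‖1 / Real.Gamma d‖ₑ * rlPotential d (Set.Ioi 0) f x := by
  rw [fracIntegral, enorm_mul, ← setLIntegral_enorm_eq_rlPotential]
  gcongr
  exact enorm_integral_le_lintegral_enorm _

/-- The fractional integral is bounded from `L^1 ∩ L^q` to `L^q`. -/
lemma exists_eLpNorm_fracIntegral_le {d q : ℝ} (hd : 0 < d) (hq : 1 < q)
    (hdq : (d - 1) * q < -1) : ∃ C : ℝ≥0∞, C ≠ ∞ ∧ ∀ f : ℝ → ℝ, AEStronglyMeasurable f volume →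
      eLpNorm (fracIntegral d f) (ENNReal.ofReal q) volume ≤
        C * (eLpNorm f (ENNReal.ofReal q) volume + eLpNorm f 1 volume) := by
  have hq0 : 0 < q := by linarith
  obtain ⟨C, hC, h⟩ := exists_rlPotential_le hd hq hdq
  refine ⟨‖1 / Real.Gamma d‖ₑ * C, ENNReal.mul_ne_top enorm_ne_top hC, fun f hf => ?_⟩
  obtain ⟨g, hg, hfg⟩ := hf
  rw [fracIntegral_congr_ae d hfg, eLpNorm_congr_ae hfg, eLpNorm_congr_ae hfg, mul_assoc]
  refine le_trans ?_ (mul_le_mul' le_rfl (h g hg.measurable))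
  rw [eLpNorm_eq_lintegral_rpow_enorm_toReal (by simpa using hq0) ENNReal.ofReal_ne_top,
    ENNReal.toReal_ofReal hq0.le]
  calc _ ≤ (∫⁻ x, (‖1 / Real.Gamma d‖ₑ * rlPotential d (Set.Ioi 0) g x) ^ q) ^ (1 / q) := by
        gcongr with x
        exact enorm_fracIntegral_le d g x
    _ = _ := by
        simp_rw [ENNReal.mul_rpow_of_nonneg _ _ hq0.le]
        rw [lintegral_const_mul _ ((measurable_rlPotential d measurableSet_Ioi
          hg.measurable).pow_const q), ENNReal.mul_rpow_of_nonneg _ _ (by positivity),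
          ← ENNReal.rpow_mul, mul_one_div_cancel hq0.ne', ENNReal.rpow_one]

lemma memLp_fracIntegral {d q : ℝ} (hd : 0 < d) (hq : 1 < q) (hdq : (d - 1) * q < -1)
    {f : ℝ → ℝ} (hf : MemB q f) : MemLp (fracIntegral d f) (ENNReal.ofReal q) volume := by
  obtain ⟨C, hC, h⟩ := exists_eLpNorm_fracIntegral_le hd hq hdq
  refine ⟨?_, (h f hf.1.1).trans_lt
    (ENNReal.mul_lt_top hC.lt_top (ENNReal.add_lt_top.2 ⟨hf.2.2, hf.1.2⟩))⟩
  rw [fracIntegral_congr_ae d hf.1.1.ae_eq_mk]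
  exact (measurable_fracIntegral d hf.1.1.stronglyMeasurable_mk.measurable).aestronglyMeasurable

/-- The potential of `|f|` has finite `L^q` norm, hence is finite almost everywhere. Subtracting
fractional integrals pointwise needs this, as a divergent Bochner integral is `0` by default. -/
lemma ae_integrableOn_fracIntegral {d q : ℝ} (hd : 0 < d) (hq : 1 < q) (hdq : (d - 1) * q < -1)
    {f : ℝ → ℝ} (hf : MemB q f) :
    ∀ᵐ x, IntegrableOn (fun t => f t * (t - x) ^ (d - 1)) (Set.Ioi x) := by
  have hq0 : 0 < q := by linarith
  obtain ⟨C, hC, h⟩ := exists_rlPotential_le hd hq hdq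
  obtain ⟨g, hg, hfg⟩ := hf.1.1
  have hfin : ∫⁻ x, rlPotential d (Set.Ioi 0) g x ^ q ≠ ∞ := fun htop => by
    have h1 := h g hg.measurable
    rw [htop, ENNReal.top_rpow_of_pos (by positivity), top_le_iff,
      ← eLpNorm_congr_ae hfg, ← eLpNorm_congr_ae hfg] at h1
    exact ENNReal.mul_ne_top hC (ENNReal.add_ne_top.2 ⟨hf.2.2.ne, hf.1.2.ne⟩) h1
  filter_upwards [ae_lt_top ((measurable_rlPotential d measurableSet_Ioi
    hg.measurable).pow_const q) hfin] with x hx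
  have hx' : rlPotential d (Set.Ioi 0) g x < ∞ := by
    by_contra hcon
    rw [not_lt, top_le_iff] at hcon
    rw [hcon, ENNReal.top_rpow_of_pos hq0] at hx
    exact lt_irrefl _ hx
  have hgi : IntegrableOn (fun t => g t * (t - x) ^ (d - 1)) (Set.Ioi x) := by
    refine ⟨?_, ?_⟩
    · have := hg.measurable
      exact Measurable.aestronglyMeasurable (by fun_prop)
    · rw [hasFiniteIntegral_iff_enorm, setLIntegral_enorm_eq_rlPotential]
      exact hx'
  refine hgi.congr (ae_restrict_of_ae ?_)
  filter_upwards [hfg] with t ht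
  rw [ht]

lemma fracIntegral_sub_ae {d q : ℝ} (hd : 0 < d) (hq : 1 < q) (hdq : (d - 1) * q < -1)
    {f g : ℝ → ℝ} (hf : MemB q f) (hg : MemB q g) :
    fracIntegral d (f - g) =ᵐ[volume] fracIntegral d f - fracIntegral d g := by
  filter_upwards [ae_integrableOn_fracIntegral hd hq hdq hf,
    ae_integrableOn_fracIntegral hd hq hdq hg] with x h1 h2
  simp only [fracIntegral, Pi.sub_apply, sub_mul]
  rw [integral_sub h1 h2, mul_sub]

/-! ### Fractional integrals of step functions and the kernels of `M_d` -/

lemma integrableOn_and_integral_indicator_Iic {d : ℝ} (hd : 0 < d) (x t : ℝ) :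
    IntegrableOn (fun u => (Set.Iic t).indicator (fun _ => (1 : ℝ)) u * (u - x) ^ (d - 1))
      (Set.Ioi x) ∧
    ∫ u in Set.Ioi x, (Set.Iic t).indicator (fun _ => (1 : ℝ)) u * (u - x) ^ (d - 1) =
      max (t - x) 0 ^ d / d := by
  have h : (fun u => (Set.Iic t).indicator (fun _ => (1 : ℝ)) u * (u - x) ^ (d - 1)) =
      (Set.Iic t).indicator fun u => (u - x) ^ (d - 1) := by
    ext u
    by_cases hu : u ∈ Set.Iic t
    · rw [Set.indicator_of_mem hu, Set.indicator_of_mem hu, one_mul]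
    · rw [Set.indicator_of_notMem hu, Set.indicator_of_notMem hu, zero_mul]
  rw [h, IntegrableOn, integrable_indicator_iff measurableSet_Iic,
    integral_indicator measurableSet_Iic, IntegrableOn, Measure.restrict_restrict
      measurableSet_Iic, Set.inter_comm, Set.Ioi_inter_Iic]
  rcases le_or_gt x t with hxt | hxt
  · rw [← intervalIntegral.integral_of_le hxt, max_eq_left (sub_nonneg.2 hxt)]
    refine ⟨(intervalIntegrable_iff_integrableOn_Ioc_of_le hxt).1 ?_, ?_⟩
    · have := (intervalIntegral.intervalIntegrable_rpow' (a := 0) (b := t - x) (r := d - 1)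
        (by linarith)).comp_sub_right x
      simpa using this
    · rw [intervalIntegral.integral_comp_sub_right (fun u => u ^ (d - 1)), sub_self,
        integral_rpow (Or.inl (by linarith)), sub_add_cancel, Real.zero_rpow hd.ne', sub_zero]
  · rw [Set.Ioc_eq_empty (not_lt.2 hxt.le), max_eq_right (sub_nonpos.2 hxt.le),
      Real.zero_rpow hd.ne']
    simp

/-- The fractional integral of a simple function is the corresponding combination of kernels. -/
lemma fracIntegral_toFun {d : ℝ} (hd : 0 < d) (φ : SimpleFn) :
    fracIntegral d φ.toFun = φ.sum fun t => (1 / Real.Gamma (d + 1)) • lfsmKernel d t := by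
  ext x
  have hint := fun t => (integrableOn_and_integral_indicator_Iic hd x t).1
  have hval := fun t => (integrableOn_and_integral_indicator_Iic hd x t).2
  -- The factor `1 / d` from integrating `(u - x) ^ (d - 1)` is absorbed by `Γ(d + 1) = d Γ(d)`.
  have hΓ : 1 / Real.Gamma (d + 1) = 1 / Real.Gamma d / d := by
    rw [Real.Gamma_add_one hd.ne']; field_simp
  have e : ∀ u, φ.toFun u * (u - x) ^ (d - 1) = ∑ i : Fin φ.n, φ.a i *
      ((Set.Iic (φ.t i.succ)).indicator (fun _ => (1 : ℝ)) u * (u - x) ^ (d - 1) -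
        (Set.Iic (φ.t i.castSucc)).indicator (fun _ => (1 : ℝ)) u * (u - x) ^ (d - 1)) := by
    intro u
    rw [φ.toFun_eq_sum]
    simp only [SimpleFn.sum, Finset.sum_apply, Pi.smul_apply, Pi.sub_apply, smul_eq_mul]
    rw [Finset.sum_mul]
    refine Finset.sum_congr rfl fun i _ => by ring
  simp only [fracIntegral, e, SimpleFn.sum, Finset.sum_apply, Pi.smul_apply, Pi.sub_apply,
    smul_eq_mul]
  rw [integral_finsetSum, Finset.mul_sum]
  swap
  · exact fun i _ => ((hint (φ.t i.succ)).sub (hint (φ.t i.castSucc))).const_mul (φ.a i)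
  refine Finset.sum_congr rfl fun i _ => ?_
  rw [integral_const_mul, integral_sub (hint _) (hint _), hval, hval, hΓ]
  -- The terms `(-x)_+^d` do not depend on `t` and cancel in the increments.
  simp only [lfsmKernel]
  ring

lemma SimpleFn.memB_toFun (φ : SimpleFn) {α : ℝ} (hα : 0 < α) : MemB α φ.toFun :=
  ⟨by simpa using φ.memLp_toFun one_pos, φ.memLp_toFun hα⟩

/-- The kernel at `0` vanishes, so each kernel is up to sign an increment, that is, a multiple of
the fractional integral of the indicator of one interval, which lies in `L^q`. -/
lemma memLp_lfsmKernel {d q : ℝ} (hd : 0 < d) (hq : 1 < q) (hdq : (d - 1) * q < -1) (t : ℝ) :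
    MemLp (lfsmKernel d t) (ENNReal.ofReal q) volume := by
  have hΓ : Real.Gamma (d + 1) ≠ 0 := (Real.Gamma_pos_of_pos (by linarith)).ne'
  have h0 : lfsmKernel d 0 = 0 := by ext x; simp [lfsmKernel]
  have key : ∀ s u, s < u →
      MemLp (lfsmKernel d u - lfsmKernel d s) (ENNReal.ofReal q) volume := by
    intro s u hsu
    let φ : SimpleFn := ⟨1, ![1], ![s, u], by
      rw [Fin.strictMono_iff_lt_succ]
      intro i
      fin_cases i
      simpa using hsu⟩
    have h := (memLp_fracIntegral hd hq hdq (φ.memB_toFun (by linarith))).const_smul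
      (Real.Gamma (d + 1))
    rw [fracIntegral_toFun hd] at h
    have e : φ.sum (fun t => (1 / Real.Gamma (d + 1)) • lfsmKernel d t) =
        (1 / Real.Gamma (d + 1)) • (lfsmKernel d u - lfsmKernel d s) := by
      simp [SimpleFn.sum, φ, smul_sub]
    rwa [e, smul_smul, mul_one_div_cancel hΓ, one_smul] at h
  rcases lt_trichotomy t 0 with ht | rfl | ht
  · simpa [h0] using (key t 0 ht).neg
  · rw [h0]; exact MemLp.zero
  · simpa [h0] using key 0 t ht

/-! ### Integration with respect to `M_d` -/

section

variable {Ω : Type*} [MeasurableSpace Ω] {P : Measure Ω} {α p d : ℝ} {L : ℝ → Ω → ℝ}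
  {g h : ℝ → ℝ} {Y Z : Ω → ℝ}

lemma IsLfsmIntegral.ae_eq (hp : 1 ≤ p) (hM : ∀ t, AEMeasurable (lfsm P α d L t) P)
    (hY : IsLfsmIntegral P α p d L g Y) (hZ : IsLfsmIntegral P α p d L g Z) : Y =ᵐ[P] Z := by
  obtain ⟨φ, hφ⟩ := hY.2.2.1
  exact ae_eq_of_tendsto_eLpNorm (by simpa using hp)
    (fun n => ((φ n).aemeasurable_integral hM).aestronglyMeasurable) hY.2.1.1 hZ.2.1.1
    (hY.2.2.2 φ hφ) (hZ.2.2.2 φ hφ)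

lemma isLfsmIntegral_lfsmIntegral (h : ∃ Y, IsLfsmIntegral P α p d L g Y) :
    IsLfsmIntegral P α p d L g (lfsmIntegral P α p d L g) := by
  rw [lfsmIntegral, dif_pos h]
  exact h.choose_spec

variable [IsProbabilityMeasure P]

lemma IsStableMotion.hasStableIntegral_sum (hL : IsStableMotion P α L) (hp : 1 ≤ p)
    (hpα : p < α) {ι : Type*} (s : Finset ι) {f : ι → ℝ → ℝ} {Y : ι → Ω → ℝ}
    (h : ∀ i, HasStableIntegral P α p L (f i) (Y i)) (c : ι → ℝ) :
    HasStableIntegral P α p L (∑ i ∈ s, c i • f i) (∑ i ∈ s, c i • Y i) := by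
  classical
  induction s using Finset.induction_on with
  | empty => simpa using hL.hasStableIntegral_zero (zero_lt_one.trans_le hp) hpα
  | insert i s hi ih =>
    rw [Finset.sum_insert hi, Finset.sum_insert hi, add_comm, add_comm (c i • Y i)]
    exact ih.add_smul (hp.trans hpα.le) hp hL.aemeasurable (h i) (c i)

lemma IsStableMotion.hasStableIntegral_lfsm (hL : IsStableMotion P α L) (hp : 1 ≤ p)
    (hpα : p < α) (hd : 0 < d) (hdα : (d - 1) * α < -1) (t : ℝ) :
    HasStableIntegral P α p L ((1 / Real.Gamma (d + 1)) • lfsmKernel d t) (lfsm P α d L t) := by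
  have h := (hL.isStableIntegral_stableIntegral hp hpα (memLp_lfsmKernel hd (hp.trans_lt hpα)
    hdα t)).hasStableIntegral hL hp hpα
  have h0 := hL.hasStableIntegral_zero (zero_lt_one.trans_le hp) hpα
  have := h0.add_smul (hp.trans hpα.le) hp hL.aemeasurable h (1 / Real.Gamma (d + 1))
  rw [zero_add, zero_add] at this
  exact this

/-- Integration by parts for simple functions. -/
lemma IsStableMotion.hasStableIntegral_fracIntegral_toFun (hL : IsStableMotion P α L)
    (hp : 1 ≤ p) (hpα : p < α) (hd : 0 < d) (hdα : (d - 1) * α < -1) (φ : SimpleFn) :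
    HasStableIntegral P α p L (fracIntegral d φ.toFun) (φ.integral (lfsm P α d L)) := by
  rw [fracIntegral_toFun hd, φ.integral_eq_sum]
  have hM := hL.hasStableIntegral_lfsm hp hpα hd hdα
  exact hL.hasStableIntegral_sum hp hpα Finset.univ (fun i : Fin φ.n =>
    (hM (φ.t i.succ)).sub (hp.trans hpα.le) hp hL.aemeasurable (hM (φ.t i.castSucc))) φ.a

/-- Passage from step functions to `g`: the stable integral of `I_-^d g` is itself a version of the
integral of `g` against `M_d`. -/
lemma IsStableMotion.isLfsmIntegral_of_hasStableIntegral (hL : IsStableMotion P α L)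
    (hp : 1 ≤ p) (hpα : p < α) (hd : 0 < d) (hdα : (d - 1) * α < -1) (hg : MemB α g)
    (hY : HasStableIntegral P α p L (fracIntegral d g) Y) : IsLfsmIntegral P α p d L g Y := by
  have hα : 1 < α := hp.trans_lt hpα
  refine ⟨hg, hY.2.1, ?_, fun φ hφ => hφ.congr fun n => ?_⟩
  · obtain ⟨C, hC, hb⟩ := exists_eLpNorm_fracIntegral_le hd hα hdα
    obtain ⟨φ, h1, h2⟩ := SimpleFn.exists_seq_tendsto hα.le hg.2
    refine ⟨φ, ?_⟩
    have hlim : Tendsto (fun n => C * (eLpNorm ((φ n).toFun - g) (ENNReal.ofReal α) volume +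
        eLpNorm ((φ n).toFun - g) 1 volume)) atTop (𝓝 0) := by
      simpa using ENNReal.Tendsto.const_mul (h1.add (h2 hg.1)) (Or.inr hC)
    have hI := tendsto_of_tendsto_of_tendsto_of_le_of_le tendsto_const_nhds hlim
      (fun _ => zero_le)
      fun n => hb ((φ n).toFun - g) ((φ n).measurable_toFun.aestronglyMeasurable.sub hg.1.1)
    simpa [normB] using ENNReal.Tendsto.const_mul hI
      (Or.inr (hL.memLp_one (zero_lt_one.trans_le hp) hpα).2.ne)
  -- The isometry applied to `I_-^d φ_n - I_-^d g` shows that the `L^p` error equals `‖φ_n -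
  -- g‖_{α,p}`.
  · have h := ((hL.hasStableIntegral_fracIntegral_toFun hp hpα hd hdα (φ n)).sub hα.le hp
      hL.aemeasurable hY).eLpNorm_eq hL hp hpα
    rw [h, normB, eLpNorm_congr_ae
      (fracIntegral_sub_ae hd hα hdα ((φ n).memB_toFun (by linarith)) hg)]

lemma IsStableMotion.fracIntegral_ae_eq_of_equivB (hL : IsStableMotion P α L)
    (hp : 0 < p) (hα : 1 < α) (hd : 0 < d) (hdα : (d - 1) * α < -1) (hg : MemB α g)
    (hh : MemB α h) (hgh : EquivB P α p d L g h) :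
    fracIntegral d g =ᵐ[volume] fracIntegral d h := by
  have h0 := (mul_eq_zero.1 hgh).resolve_left (hL.eLpNorm_one_ne_zero (by linarith) hp)
  have hB : MemB α (g - h) := ⟨hg.1.sub hh.1, hg.2.sub hh.2⟩
  rw [eLpNorm_eq_zero_iff (memLp_fracIntegral hd hα hdα hB).1
    (by simpa using zero_lt_one.trans hα)] at h0
  filter_upwards [h0, fracIntegral_sub_ae hd hα hdα hg hh] with x hx hx'
  rw [hx] at hx'
  exact sub_eq_zero.1 hx'.symm

end

end StableIBP

/-! ### The integration by parts formula -/

theorem theorem3p2 {Ω : Type*} [MeasurableSpace Ω] (P : Measure Ω) [IsProbabilityMeasure P]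
    (α p d : ℝ) (hα₁ : 1 < α) (hα₂ : α < 2) (hp₁ : 1 < p) (hpα : p < α)
    (hd₀ : 0 < d) (hd₁ : d < 1 - 1 / α)
    (L : ℝ → Ω → ℝ) (hL : StableIBP.IsStableMotion P α L)
    (g : ℝ → ℝ) (hg : StableIBP.MemB α g) :
    -- the integrals defining the linear fractional stable motion exist
    (∀ t, StableIBP.IsStableIntegral P α L (StableIBP.lfsmKernel d t)
      (StableIBP.stableIntegral P α L (StableIBP.lfsmKernel d t))) ∧
    -- the integral of `g` with respect to the linear fractional stable motion exists
    StableIBP.IsLfsmIntegral P α p d L g (StableIBP.lfsmIntegral P α p d L g) ∧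
    -- it depends only on the class of `g` in `B_{α,p}`
    (∀ h, StableIBP.MemB α h → StableIBP.EquivB P α p d L g h →
      StableIBP.lfsmIntegral P α p d L h =ᵐ[P] StableIBP.lfsmIntegral P α p d L g) ∧
    -- the integral of the fractional integral of `g` with respect to `L` exists
    StableIBP.IsStableIntegral P α L (StableIBP.fracIntegral d g)
      (StableIBP.stableIntegral P α L (StableIBP.fracIntegral d g)) ∧
    -- the two integrals agree
    StableIBP.lfsmIntegral P α p d L g
      =ᵐ[P] StableIBP.stableIntegral P α L (StableIBP.fracIntegral d g) := by
  have hα0 : 0 < α := by linarith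
  have hdα : (d - 1) * α < -1 := by
    have : d - 1 < -(1 / α) := by linarith
    calc (d - 1) * α < -(1 / α) * α := by gcongr
      _ = -1 := by field_simp
  have hI : ∀ f, StableIBP.MemB α f → StableIBP.IsStableIntegral P α L
      (StableIBP.fracIntegral d f) (StableIBP.stableIntegral P α L (StableIBP.fracIntegral d f)) :=
    fun f hf => hL.isStableIntegral_stableIntegral hp₁.le hpα
      (StableIBP.memLp_fracIntegral hd₀ hα₁ hdα hf)
  have hS : ∀ f, StableIBP.MemB α f → StableIBP.HasStableIntegral P α p L
      (StableIBP.fracIntegral d f) (StableIBP.stableIntegral P α L (StableIBP.fracIntegral d f)) :=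
    fun f hf => (hI f hf).hasStableIntegral hL hp₁.le hpα
  have hM : ∀ t, AEMeasurable (StableIBP.lfsm P α d L t) P := fun t =>
    (hL.hasStableIntegral_lfsm hp₁.le hpα hd₀ hdα t).2.1.1.aemeasurable
  have hlfsm : ∀ f, StableIBP.MemB α f → ∀ Y, StableIBP.HasStableIntegral P α p L
      (StableIBP.fracIntegral d f) Y → StableIBP.lfsmIntegral P α p d L f =ᵐ[P] Y := by
    intro f hf Y hY
    have h := hL.isLfsmIntegral_of_hasStableIntegral hp₁.le hpα hd₀ hdα hf hY
    exact (StableIBP.isLfsmIntegral_lfsmIntegral ⟨_, h⟩).ae_eq hp₁.le hM h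
  refine ⟨fun t => hL.isStableIntegral_stableIntegral hp₁.le hpα
      (StableIBP.memLp_lfsmKernel hd₀ hα₁ hdα t),
    StableIBP.isLfsmIntegral_lfsmIntegral
      ⟨_, hL.isLfsmIntegral_of_hasStableIntegral hp₁.le hpα hd₀ hdα hg (hS g hg)⟩,
    fun h hh hgh => ?_, hI g hg, hlfsm g hg _ (hS g hg)⟩
  -- Equivalent integrands have almost everywhere equal fractional integrals, so one random variable
  -- is a version of both integrals.
  have hae := hL.fracIntegral_ae_eq_of_equivB (by linarith) hα₁ hd₀ hdα hg hh hgh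
  exact (hlfsm h hh _ ((hS g hg).congr_left hae)).trans (hlfsm g hg _ (hS g hg)).symm
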